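/- **Setting.** Let $\nu\ge 1$ be an integer and $\Gamma=\bigoplus_{i=1}^{\nu}\mathbb{Z}\epsilon_i$ with $(\epsilon_i,\epsilon_j)=\delta_{ij}$. Let $\varepsilon:\Gamma\times\Gamma\to\{\pm1\}$ be the bimultiplicative map with $\varepsilon(\epsilon_i,\epsilon_j)=1$ if $i\le j$ and $-1$ if $i>j$; it depends only on classes modulo $2\Gamma$. Let $\mathbb{C}[\Gamma/2\Gamma]$ be the twisted group algebra with basis $e^{x}$, $x\in\Gamma/2\Gamma$, and product $e^{\bar\alpha}e^{\bar\beta}=\varepsilon(\alpha,\beta)e^{\overline{\alpha+\beta}}$. Let $\mathcal{H}$ be the Heisenberg Lie algebra spanned by $1$ and $\epsilon_i(n)$ ($1\le i\le\nu$, $n$ odd) with $[\epsilon_i(m),\epsilon_j(n)]=\frac m2\delta_{ij}\delta_{m+n,0}$, let $\mathcal{H}^-$ be the span of the $\epsilon_i(n)$ with $n<0$, and let $M=\mathbb{C}[\Gamma/2\Gamma]\otimes S(\mathcal{H}^-)$. Here $e^{x}$ acts on the first factor by left multiplication; on the second factor $\epsilon_i(n)$ acts by multiplication if $n<0$, and if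 $n>0$ as the derivation sending $\epsilon_j(-m)$ to $\frac n2\delta_{ij}\delta_{mn}$. For $\alpha=\sum_i m_i\epsilon_i\in\Gamma$ put $\alpha(n)=\sum_i m_i\epsilon_i(n)$ and $$E_\pm(\alpha,z)=\exp\Big(-2\sum_{n\in\pm\{1,3,5,\dots\}}\frac{\alpha(n)}{n}z^{-n}\Big).$$ For $a\in\mathbb{C}^\times$ and $1\le i,j\le\nu$ define the formal series $X_{ij}(a,z)$, with coefficients in $\operatorname{End}(M)$, by $$X_{ij}(a,z)=\begin{cases}\varepsilon(\epsilon_i,\epsilon_j)\,e^{\overline{\epsilon_i-\epsilon_j}}E_-(\epsilon_i,z)E_-(-\epsilon_j,az)E_+(\epsilon_i,z)E_+(-\epsilon_j,az), & i\ne j,\\[2pt] 4\sum_{n\ \mathrm{odd}}\epsilon_i(n)z^{-n}, & i=j,\ a=1,\\[2pt] \frac{1+a}{1-a}\big(E_-(\epsilon_i,z)E_-(-\epsilon_i,az)E_+(\epsilon_i,z)E_+(-\epsilon_i,az)-1\big), & i=j,\ a\ne1.\end{cases}$$ Let $\delta(x)=\sum_{n\in\mathbb{Z}}x^n$ and $(D\delta)(x)=\sum_{n\in\mathbb{Z}}n\,x^n$,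 and let $\delta_{x,y}$ be the Kronecker symbol. **Theorem.** For all $1\le i,j,k,l\le\nu$ and all $a,b\in\mathbb{C}^\times$, the following identity of formal series in $z^{\pm1},w^{\pm1}$ with coefficients in $\operatorname{End}(M)$ holds: $$\begin{aligned}[X_{ij}(a,z),X_{kl}(b,w)] ={}&2\delta_{jk}\Big(X_{il}(ab,z)+\delta_{il}(1-\delta_{ab,1})\tfrac{1+ab}{1-ab}\Big)\delta\big(\tfrac{w}{az}\big)\\ &-2\delta_{il}\Big(X_{kj}(ab,b^{-1}z)+\delta_{jk}(1-\delta_{ab,1})\tfrac{1+ab}{1-ab}\Big)\delta\big(\tfrac{bw}{z}\big)\\ &+2\delta_{ik}\Big(X_{lj}(ab^{-1},bz)+\delta_{jl}(1-\delta_{a,b})\tfrac{1+ab^{-1}}{1-ab^{-1}}\Big)\delta\big(-\tfrac{w}{z}\big)\\ &-2\delta_{jl}\Big(X_{ik}(ab^{-1},z)+\delta_{ik}(1-\delta_{a,b})\tfrac{1+ab^{-1}}{1-ab^{-1}}\Big)\delta\big(-\tfrac{bw}{az}\big)\\ &+4\delta_{il}\delta_{jk}\delta_{ab,1}(D\delta)\big(\tfrac{w}{az}\big)-4\delta_{ik}\delta_{jl}\delta_{a,b}(D\delta)\big(-\tfrac{w}{z}\big).\end{aligned}$$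 A scalar term whose denominator vanishes occurs only multiplied by $0$ and is read as $0$. -/

import Mathlib

noncomputable section

namespace TwistedVertex

/-! ### The lattice, its reduction modulo two, and the twisted group algebra -/

/-- The lattice `Γ = ⨁ ℤ ε_i` of rank `ν`, with the standard form `(ε_i, ε_j) = δ_ij`. -/
abbrev LatticeZ (ν : ℕ) : Type := Fin ν → ℤ

/-- The basis vector `ε_i` of `Γ`. -/
def basisVec {ν : ℕ} (i : Fin ν) : LatticeZ ν := Pi.single i 1

/-- The subgroup `2Γ` of `Γ`. -/
def twoLattice (ν : ℕ) : AddSubgroup (LatticeZ ν) :=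
  (zsmulAddGroupHom (α := LatticeZ ν) 2).range

/-- The finite group `Γ / 2Γ`. -/
abbrev LatticeBar (ν : ℕ) : Type := LatticeZ ν ⧸ twoLattice ν

/-- `ε(ε_i, ε_j)`, which is `1` for `i ≤ j` and `-1` for `i > j`. -/
def cocycleBasis {ν : ℕ} (i j : Fin ν) : ℤˣ := if i ≤ j then 1 else -1

/-- The bimultiplicative two-cocycle `ε : Γ × Γ → {±1}`. -/
def cocycle {ν : ℕ} (α β : LatticeZ ν) : ℤˣ :=
  ∏ i, ∏ j, cocycleBasis i j ^ (α i * β j)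

theorem cocycle_add_left {ν : ℕ} (α α' β : LatticeZ ν) :
    cocycle (α + α') β = cocycle α β * cocycle α' β := by
  simp only [cocycle, ← Finset.prod_mul_distrib, Pi.add_apply, add_mul, zpow_add]

theorem cocycle_add_right {ν : ℕ} (α β β' : LatticeZ ν) :
    cocycle α (β + β') = cocycle α β * cocycle α β' := by
  simp only [cocycle, ← Finset.prod_mul_distrib, Pi.add_apply, mul_add, zpow_add]

theorem cocycle_two_left {ν : ℕ} (α β : LatticeZ ν) : cocycle ((2 : ℤ) • α) β = 1 := by
  rw [two_smul, cocycle_add_left, Int.units_mul_self]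

theorem cocycle_two_right {ν : ℕ} (α β : LatticeZ ν) : cocycle α ((2 : ℤ) • β) = 1 := by
  rw [two_smul, cocycle_add_right, Int.units_mul_self]

/-- The cocycle on `Γ / 2Γ`; it is well defined. -/
def cocycleBar {ν : ℕ} (x y : LatticeBar ν) : ℤˣ :=
  Quotient.liftOn₂' x y cocycle (by
    intro a b a' b' h h'
    rw [QuotientAddGroup.leftRel_apply] at h h'
    obtain ⟨c, hc⟩ := h
    obtain ⟨d, hd⟩ := h'
    have h1 : a' = a + (2 : ℤ) • c := by
      rw [show (2 : ℤ) • c = -a + a' from hc, add_neg_cancel_left]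
    have h2 : b' = b + (2 : ℤ) • d := by
      rw [show (2 : ℤ) • d = -b + b' from hd, add_neg_cancel_left]
    rw [h1, h2, cocycle_add_left, cocycle_add_right, cocycle_two_left, cocycle_two_right]
    simp)

/-- The underlying space of the twisted group algebra `ℂ[Γ/2Γ]`; the basis vector `e^x` is
`Finsupp.single x 1`. -/
abbrev GroupAlg (ν : ℕ) : Type := LatticeBar ν →₀ ℂ

/-- Left multiplication by `e^x` in the twisted group algebra:
`e^x e^y = ε(x, y) e^(x + y)`. -/
def expOp {ν : ℕ} (x : LatticeBar ν) : Module.End ℂ (GroupAlg ν) :=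
  Finsupp.linearCombination ℂ fun y =>
    (((cocycleBar x y : ℤˣ) : ℤ) : ℂ) • Finsupp.single (x + y) (1 : ℂ)

/-! ### The Heisenberg modes on the symmetric algebra -/

/-- The indices `(i, n)`, `n` odd positive, of the basis `ε_i(-n)` of `H⁻`. -/
abbrev ModeIndex (ν : ℕ) : Type := Fin ν × {n : ℕ // Odd n}

/-- The symmetric algebra `S(H⁻)`, as the polynomial algebra on the basis of `H⁻`: the
variable with index `(i, n)` is `ε_i(-n)`. -/
abbrev SymAlg (ν : ℕ) : Type := MvPolynomial (ModeIndex ν) ℂ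

/-- The operator `ε_i(n)` on `S(H⁻)` for odd `n`: multiplication by the variable `ε_i(n)` when
`n < 0`, and the derivation sending `ε_j(-m)` to `(n/2) δ_ij δ_mn` when `n > 0`.
For even `n` the value is `0`. -/
def basisMode {ν : ℕ} (i : Fin ν) (n : ℤ) : Module.End ℂ (SymAlg ν) :=
  if h : Odd n.natAbs then
    if 0 < n then ((n : ℂ) / 2) • (MvPolynomial.pderiv (R := ℂ) (i, ⟨n.natAbs, h⟩)).toLinearMap
    else LinearMap.mulLeft ℂ (MvPolynomial.X (i, ⟨n.natAbs, h⟩))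
  else 0

/-- The operator `α(n)` for `α ∈ Γ`, linear in `α`. -/
def mode {ν : ℕ} (α : LatticeZ ν) (n : ℤ) : Module.End ℂ (SymAlg ν) :=
  ∑ i, (α i : ℂ) • basisMode i n

/-! ### Exponentials -/

/-- The exponential `∑ f^l / l!` of a power series `f` without constant term: the terms with
`l > n` do not contribute to the coefficient of degree `n`. -/
def expSeries {A : Type*} [Ring A] [Algebra ℂ A] (f : PowerSeries A) : PowerSeries A :=
  PowerSeries.mk fun n =>
    ∑ l ∈ Finset.range (n + 1), ((l.factorial : ℂ)⁻¹) • PowerSeries.coeff n (f ^ l)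

/-- The coefficient `-2 α(n) c^(-n) / n` of `z^(-n)` in `-2 ∑ α(n)/n (cz)^(-n)`. -/
def exponent {ν : ℕ} (α : LatticeZ ν) (c : ℂˣ) (n : ℤ) : Module.End ℂ (SymAlg ν) :=
  (-2 / (n : ℂ) * (c : ℂ) ^ (-n)) • mode α n

/-- `E_-(α, cz)`, as a power series in `z`. -/
def EMinus {ν : ℕ} (α : LatticeZ ν) (c : ℂˣ) : PowerSeries (Module.End ℂ (SymAlg ν)) :=
  expSeries (PowerSeries.mk fun k => exponent α c (-(k : ℤ)))

/-- `E_+(α, cz)`, as a power series in `z⁻¹`. -/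
def EPlus {ν : ℕ} (α : LatticeZ ν) (c : ℂˣ) : PowerSeries (Module.End ℂ (SymAlg ν)) :=
  expSeries (PowerSeries.mk fun k => exponent α c (k : ℤ))

/-! ### Local finiteness of `E_+` -/

/-- A power series of operators is locally finite if every vector is annihilated by all but
finitely many of its coefficients. -/
def LocallyFinite {V : Type*} [AddCommGroup V] [Module ℂ V]
    (B : PowerSeries (Module.End ℂ V)) : Prop :=
  ∀ v : V, ∃ N : ℕ, ∀ q : ℕ, N ≤ q → PowerSeries.coeff q B v = 0

/-- The weight of a monomial, where `ε_i(-n)` has weight `n`. -/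
def monWeight {ν : ℕ} (m : ModeIndex ν →₀ ℕ) : ℕ :=
  Finsupp.weight (fun x : ModeIndex ν => (x.2 : ℕ)) m

/-- The polynomials all of whose monomials have weight at most `d`. -/
def filt (ν : ℕ) (d : ℤ) : Submodule ℂ (SymAlg ν) where
  carrier := {v | ∀ m, MvPolynomial.coeff m v ≠ 0 → (monWeight m : ℤ) ≤ d}
  zero_mem' := fun m hm => absurd (MvPolynomial.coeff_zero m) hm
  add_mem' := fun {v w} hv hw m hm => by
    by_cases h : MvPolynomial.coeff m v = 0
    · exact hw m fun h' => hm (by rw [MvPolynomial.coeff_add, h, h', add_zero])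
    · exact hv m h
  smul_mem' := fun c v hv m hm => hv m fun h => hm (by
    rw [MvPolynomial.coeff_smul, h, smul_zero])

/-- The coefficient of degree `q` lowers the weight by at least `q`. -/
def Lowering {ν : ℕ} (B : PowerSeries (Module.End ℂ (SymAlg ν))) : Prop :=
  ∀ (q : ℕ) (d : ℤ) (v : SymAlg ν), v ∈ filt ν d → PowerSeries.coeff q B v ∈ filt ν (d - q)

theorem Lowering.one {ν : ℕ} : Lowering (ν := ν) 1 := by
  intro q d v hv
  rw [PowerSeries.coeff_one]
  split_ifs with h
  · subst h; simpa using hv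
  · exact Submodule.zero_mem _

theorem Lowering.mul {ν : ℕ} {A B : PowerSeries (Module.End ℂ (SymAlg ν))}
    (hA : Lowering A) (hB : Lowering B) : Lowering (A * B) := by
  intro q d v hv
  rw [PowerSeries.coeff_mul, LinearMap.sum_apply]
  refine Submodule.sum_mem _ fun p hp => ?_
  have h := hA p.1 _ _ (hB p.2 d v hv)
  rw [← show p.1 + p.2 = q by simpa using hp]
  push_cast
  rwa [add_comm (p.1 : ℤ), ← sub_sub]

theorem Lowering.pow {ν : ℕ} {A : PowerSeries (Module.End ℂ (SymAlg ν))}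
    (hA : Lowering A) (l : ℕ) : Lowering (A ^ l) := by
  induction l with
  | zero => rw [pow_zero]; exact Lowering.one
  | succ l ih => rw [pow_succ]; exact ih.mul hA

theorem Lowering.expSeries {ν : ℕ} {A : PowerSeries (Module.End ℂ (SymAlg ν))}
    (hA : Lowering A) : Lowering (expSeries A) := by
  intro q d v hv
  rw [TwistedVertex.expSeries, PowerSeries.coeff_mk, LinearMap.sum_apply]
  exact Submodule.sum_mem _ fun l _ => Submodule.smul_mem _ _ (hA.pow l q d v hv)

theorem Lowering.locallyFinite {ν : ℕ} {B : PowerSeries (Module.End ℂ (SymAlg ν))}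
    (hB : Lowering B) : LocallyFinite B := by
  intro v
  refine ⟨v.support.sup monWeight + 1, fun q hq => ?_⟩
  have hv : v ∈ filt ν ((v.support.sup monWeight : ℕ) : ℤ) := by
    intro m hm
    exact Int.ofNat_le.mpr
      (Finset.le_sup (f := monWeight) (MvPolynomial.mem_support_iff.mpr hm))
  have h := hB q _ v hv
  refine MvPolynomial.ext _ _ fun m => ?_
  rw [MvPolynomial.coeff_zero]
  by_contra hm
  have := h m hm
  omega

theorem pderiv_mem_filt {ν : ℕ} (x : ModeIndex ν) (d : ℤ) (v : SymAlg ν) (hv : v ∈ filt ν d) :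
    MvPolynomial.pderiv (R := ℂ) x v ∈ filt ν (d - (x.2 : ℕ)) := by
  rw [← MvPolynomial.support_sum_monomial_coeff v, map_sum]
  refine Submodule.sum_mem _ fun m hm => ?_
  rw [MvPolynomial.pderiv_monomial]
  by_cases hx : m x = 0
  · simp [hx]
  · have h1 : (monWeight m : ℤ) ≤ d := hv m (MvPolynomial.mem_support_iff.mp hm)
    have h2 := Finsupp.weight_sub_single_add (w := fun x : ModeIndex ν => (x.2 : ℕ)) hx
    intro m' hm'
    rw [MvPolynomial.coeff_monomial] at hm'
    have h3 : m - Finsupp.single x 1 = m' := by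
      by_contra hne
      exact hm' (if_neg hne)
    rw [← h3]
    simp only [monWeight] at h1 ⊢
    omega

theorem lowering_exponent {ν : ℕ} (α : LatticeZ ν) (c : ℂˣ) :
    Lowering (PowerSeries.mk fun k => exponent α c (k : ℤ)) := by
  intro q d v hv
  rw [PowerSeries.coeff_mk, exponent, mode, LinearMap.smul_apply, LinearMap.sum_apply]
  refine Submodule.smul_mem _ _ (Submodule.sum_mem _ fun i _ => Submodule.smul_mem _ _ ?_)
  rw [basisMode]
  split_ifs with h h'
  · exact Submodule.smul_mem _ _ (pderiv_mem_filt (i, ⟨_, h⟩) d v hv)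
  · rcases Nat.eq_zero_or_pos q with rfl | hq
    · simp at h
    · omega
  · exact Submodule.zero_mem _

theorem lowering_EPlus {ν : ℕ} (α : LatticeZ ν) (c : ℂˣ) : Lowering (EPlus α c) :=
  (lowering_exponent α c).expSeries

/-! ### The vertex operators -/

/-- For a power series `A` in `z` and a locally finite power series `B` in `z⁻¹`, the
coefficient of `z^n` in the product `A B`, that is, the operator
`∑_{p - q = n} A_p B_q`, which is a finite sum on every vector. -/
def mixedCoeff {V : Type*} [AddCommGroup V] [Module ℂ V]
    (A B : PowerSeries (Module.End ℂ V)) (hB : LocallyFinite B) (n : ℤ) : Module.End ℂ V :=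
  have fin : ∀ v : V, (Function.support fun r : {r : ℕ × ℕ // (r.1 : ℤ) - r.2 = n} =>
      PowerSeries.coeff r.1.1 A (PowerSeries.coeff r.1.2 B v)).Finite := by
    intro v
    obtain ⟨N, hN⟩ := hB v
    refine Set.Finite.of_finite_image (f := fun r => r.1.2) ?_ ?_
    · refine (Set.finite_lt_nat N).subset ?_
      rintro _ ⟨r, hr, rfl⟩
      by_contra hlt
      exact hr (by simp only [hN _ (not_lt.mp hlt), map_zero])
    · rintro ⟨⟨p, q⟩, h⟩ _ ⟨⟨p', q'⟩, h'⟩ _ hqq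
      simp only [Subtype.mk.injEq, Prod.mk.injEq] at h h' hqq ⊢
      omega
  { toFun := fun v => ∑ᶠ r : {r : ℕ × ℕ // (r.1 : ℤ) - r.2 = n},
      PowerSeries.coeff r.1.1 A (PowerSeries.coeff r.1.2 B v)
    map_add' := fun v w => by
      simp only [map_add]
      exact finsum_add_distrib (fin v) (fin w)
    map_smul' := fun c v => by
      simp only [map_smul, RingHom.id_apply]
      exact (smul_finsum' c (fin v)).symm }

/-- The coefficient of `z^n` in
`E_-(ε_i, z) E_-(-ε_j, az) E_+(ε_i, z) E_+(-ε_j, az)`, acting on `S(H⁻)`. -/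
def bosonCoeff {ν : ℕ} (i j : Fin ν) (a : ℂˣ) (n : ℤ) : Module.End ℂ (SymAlg ν) :=
  mixedCoeff (EMinus (basisVec i) 1 * EMinus (-basisVec j) a)
    (EPlus (basisVec i) 1 * EPlus (-basisVec j) a)
    ((lowering_EPlus _ _).mul (lowering_EPlus _ _)).locallyFinite n

/-- The Fock space `M = ℂ[Γ/2Γ] ⊗ S(H⁻)`. -/
abbrev Fock (ν : ℕ) : Type := TensorProduct ℂ (GroupAlg ν) (SymAlg ν)

instance (ν : ℕ) : AddCommGroup (Fock ν) := TensorProduct.addCommGroup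

/-- The operator `g ⊗ f` on the Fock space. -/
def tensorOp {ν : ℕ} (g : Module.End ℂ (GroupAlg ν)) (f : Module.End ℂ (SymAlg ν)) :
    Module.End ℂ (Fock ν) :=
  TensorProduct.map g f

/-- The formal series `∑ A_n z^n`, `n ∈ ℤ`, with coefficients in `V`, as the family of its
coefficients. -/
abbrev Series (V : Type*) : Type _ := ℤ → V

/-- The formal series `∑ A_{p,q} z^p w^q`, `p, q ∈ ℤ`, with coefficients in `V`. -/
abbrev Series₂ (V : Type*) : Type _ := ℤ → ℤ → V

/-- The constant series `c`. -/
def constSeries {V : Type*} [Zero V] (c : V) : Series V := fun n => if n = 0 then c else 0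

/-- The twisted vertex operator `X_ij(a, z)` on the Fock space; its value at `n` is the
coefficient of `z^n`, so that `x_ij(a, n)` is the value at `-n`. -/
def vertexOp {ν : ℕ} (i j : Fin ν) (a : ℂˣ) : Series (Module.End ℂ (Fock ν)) := fun n =>
  if i = j then
    if a = 1 then (4 : ℂ) • tensorOp 1 (basisMode i (-n))
    else ((1 + (a : ℂ)) / (1 - (a : ℂ))) • (tensorOp 1 (bosonCoeff i i a n) - constSeries 1 n)
  else
    (((cocycle (basisVec i) (basisVec j) : ℤˣ) : ℤ) : ℂ) •
      tensorOp (expOp (QuotientAddGroup.mk (basisVec i - basisVec j))) (bosonCoeff i j a n)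

/-! ### Calculus of formal series -/

/-- The series `A(cz)`. -/
def scale {V : Type*} [AddCommGroup V] [Module ℂ V] (A : Series V) (c : ℂˣ) : Series V :=
  fun n => ((c : ℂ) ^ n) • A n

/-- The formal delta series `δ(x) = ∑ x^n`. -/
def delta : Series ℂ := fun _ => 1

/-- The operator `D = x d/dx`. -/
def euler (f : Series ℂ) : Series ℂ := fun n => (n : ℂ) * f n

/-- The series `f(cw/z)` in `z` and `w`. -/
def substRatio (f : Series ℂ) (c : ℂˣ) : Series₂ ℂ :=
  fun p q => if p + q = 0 then f q * (c : ℂ) ^ q else 0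

/-- The product `A(z) d(z, w)` of formal series; for `d(z, w) = f(cw/z)` at most one term
contributes to each coefficient. -/
def mulSeries {V : Type*} [AddCommGroup V] [Module ℂ V] (A : Series V) (d : Series₂ ℂ) :
    Series₂ V :=
  fun p q => ∑ᶠ r : ℤ, d (p - r) q • A r

/-- The constant multiple `d(z, w) T`. -/
def smulConst {V : Type*} [AddCommGroup V] [Module ℂ V] (d : Series₂ ℂ) (T : V) : Series₂ V :=
  fun p q => d p q • T

/-- The commutator `[A(z), B(w)]`. -/
def seriesBracket {V : Type*} [AddCommGroup V] [Module ℂ V] (A B : Series (Module.End ℂ V)) :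
    Series₂ (Module.End ℂ V) :=
  fun p q => A p * B q - B q * A p

/-- The Kronecker symbol. -/
def kron {ι : Type*} [DecidableEq ι] (x y : ι) : ℂ := if x = y then 1 else 0

end TwistedVertex

end

open TwistedVertex

noncomputable section

namespace TwistedVertex

/-! ### Finite sums and pointwise finite sums of operators -/

/-! This is the boson-fermion correspondence. Put ψ_i(z) = e^(ε_i) E_-(ε_i, z) E_+(ε_i, z). Only odd
modes occur, so E_±(-ε_j, az) = E_±(ε_j, -az), and X_ij(a, z) should be ψ_i(z) ψ_j(-az) minus its
vacuum expectation. Once the ψ_i are known to be fermions, the theorem is a commutator computation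
with quadratic expressions in a Clifford algebra.

The fermion relations rest on ψ_i(z) ψ_i(w) = (1 - x)/(1 + x) N(z, w) with x = w/z and N the
normally ordered product. Denominators are cleared, giving (1 + x) ψ_i(z) ψ_i(w) = (1 - x) N(z, w)
(`vertexMode_mul_self_add`). Since N is symmetric and N(z, -z) = 1, this recursion forces {ψ_i(m),
ψ_i(n)} = 2 (-1)^n δ_(m+n,0) (`vertexMode_anticomm`). For i ≠ j the bosonic parts commute and the
cocycle supplies the sign -1 (`expBasis_mul_of_ne`).

Putting w = -az in the vacuum-subtracted recursion gives (1 - a) X = (1 + a)(N(z, -az) - 1), which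
is the definition of X_ii for a ≠ 1; at a = 1 the derivative of N at w = -z gives 4 ∑ ε_i(n) z^(-n)
instead (`hasOpSum_bilinear_self`). Thus `vertexOp` is a family of fermion bilinears
(`isFermionBilinear_vertexOp`).

Commuting a bilinear with one fermion, then with a product of two, leaves four bilinears. Their
vacuum expectations, taken at shifted indices, do not cancel: the remainder `vacuumDefect` supplies
the scalars (1 + u)/(1 - u), and the Dδ terms when u = 1.

All infinite sums are finite on each vector. `HasFinsum` and `HasOpSum` keep the finiteness together
with the value, because `finsum` is 0 on infinite supports. -/

/-- The family `f` has finite support and sum `x`. -/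
def HasFinsum {ι V : Type*} [AddCommGroup V] (f : ι → V) (x : V) : Prop :=
  (Function.support f).Finite ∧ ∑ᶠ i, f i = x

namespace HasFinsum

variable {ι κ V W : Type*} [AddCommGroup V] [AddCommGroup W] {f g : ι → V} {x y : V}

theorem unique (h : HasFinsum f x) (h' : HasFinsum f y) : x = y := h.2.symm.trans h'.2

theorem congr (h : HasFinsum f x) (hfg : ∀ i, g i = f i) : HasFinsum g x := by
  rwa [show g = f from funext hfg]

theorem add (h : HasFinsum f x) (h' : HasFinsum g y) : HasFinsum (fun i => f i + g i) (x + y) :=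
  ⟨(h.1.union h'.1).subset (Function.support_add f g), by
    rw [finsum_add_distrib h.1 h'.1, h.2, h'.2]⟩

theorem sub (h : HasFinsum f x) (h' : HasFinsum g y) : HasFinsum (fun i => f i - g i) (x - y) :=
  ⟨(h.1.union h'.1).subset (Function.support_sub f g), by
    rw [finsum_sub_distrib h.1 h'.1, h.2, h'.2]⟩

theorem map (φ : V →+ W) (h : HasFinsum f x) : HasFinsum (fun i => φ (f i)) (φ x) :=
  ⟨h.1.subset fun i hi hf => hi (by simp [hf]), by
    rw [← h.2, ← AddMonoidHom.map_finsum φ h.1]⟩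

theorem of_equiv (e : κ ≃ ι) (h : HasFinsum f x) : HasFinsum (fun k => f (e k)) x :=
  ⟨h.1.preimage e.injective.injOn, by rw [finsum_comp_equiv e, h.2]⟩

theorem single (i : ι) (h : ∀ j, j ≠ i → f j = 0) : HasFinsum f (f i) :=
  ⟨(Set.finite_singleton i).subset fun j hj => by_contra fun hne => hj (h j hne),
    finsum_eq_single f i h⟩

theorem zero : HasFinsum (fun _ : ι => (0 : V)) 0 :=
  ⟨by simp [Function.support], finsum_zero⟩

theorem prod_fiberwise {f : ι × κ → V} {g : ι → V} (h : HasFinsum f x)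
    (hg : ∀ i, HasFinsum (fun k => f (i, k)) (g i)) : HasFinsum g x := by
  have hgf : g = fun i => ∑ᶠ k, f (i, k) := funext fun i => (hg i).2.symm
  refine ⟨(h.1.image Prod.fst).subset fun i hi => ?_, ?_⟩
  · by_contra hne
    refine hi ?_
    rw [hgf]
    refine finsum_eq_zero_of_forall_eq_zero fun k => ?_
    by_contra hk
    exact hne ⟨(i, k), hk, rfl⟩
  · rw [← h.2, finsum_curry f h.1, hgf]

/-- A function on `ℤ` that vanishes near `-∞` and equals `x` near `+∞` has increments summing to
`x`. -/
theorem telescope {ρ : ℤ → V} (L : ℤ) (h0 : ∀ n ≤ -L, ρ n = 0) (h1 : ∀ n, L ≤ n → ρ n = x) :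
    HasFinsum (fun n => ρ n - ρ (n - 1)) x := by
  -- Subtracting a step function leaves a finitely supported `u`, whose increments sum to zero; the
  -- step function jumps by `x` once, at `0`.
  set u : ℤ → V := fun n => ρ n - if 0 ≤ n then x else 0 with hu
  have hfin : (Function.support u).Finite := by
    refine (Set.finite_Icc (-|L|) |L|).subset fun n hn => ?_
    by_contra hne
    rw [Set.mem_Icc, not_and_or, not_le, not_le] at hne
    refine hn ?_
    have := neg_abs_le L
    have := le_abs_self L
    have := abs_nonneg L
    rcases hne with h | h
    · simp only [hu]
      rw [h0 n (by omega), if_neg (by omega), sub_zero]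
    · simp only [hu]
      rw [h1 n (by omega), if_pos (by omega), sub_self]
  have hs : HasFinsum u (∑ᶠ n, u n) := ⟨hfin, rfl⟩
  have hs' := hs.of_equiv (Equiv.subRight (1 : ℤ))
  have hd : HasFinsum (fun n : ℤ => (if 0 ≤ n then x else 0) - if 0 ≤ n - 1 then x else 0) x := by
    have := single (f := fun n : ℤ => (if 0 ≤ n then x else 0) - if 0 ≤ n - 1 then x else 0) 0
      (by
        intro j hj
        by_cases h : 0 ≤ j
        · simp [h, show 1 ≤ j by omega]
        · simp [h, show ¬ 1 ≤ j by omega])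
    simpa using this
  have := (hs.sub hs').add hd
  rw [sub_self, zero_add] at this
  convert this using 2 with n
  simp only [hu, Equiv.subRight_apply]
  abel

end HasFinsum

/-- The family `f` of operators has, on each vector, finite support and sum given by `T`. -/
def HasOpSum {ι V : Type*} [AddCommGroup V] [Module ℂ V] (f : ι → Module.End ℂ V)
    (T : Module.End ℂ V) : Prop :=
  ∀ v, HasFinsum (fun i => f i v) (T v)

namespace HasOpSum

variable {ι κ V : Type*} [AddCommGroup V] [Module ℂ V] {f g : ι → Module.End ℂ V}
  {T U : Module.End ℂ V}

theorem unique (h : HasOpSum f T) (h' : HasOpSum f U) : T = U :=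
  LinearMap.ext fun v => (h v).unique (h' v)

theorem congr (h : HasOpSum f T) (hfg : ∀ i, g i = f i) : HasOpSum g T := by
  rwa [show g = f from funext hfg]

theorem congr' (h : HasOpSum f T) (hTU : T = U) : HasOpSum f U := hTU ▸ h

theorem add (h : HasOpSum f T) (h' : HasOpSum g U) : HasOpSum (fun i => f i + g i) (T + U) :=
  fun v => (h v).add (h' v)

theorem sub (h : HasOpSum f T) (h' : HasOpSum g U) : HasOpSum (fun i => f i - g i) (T - U) :=
  fun v => (h v).sub (h' v)

theorem mul_left (A : Module.End ℂ V) (h : HasOpSum f T) : HasOpSum (fun i => A * f i) (A * T) :=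
  fun v => (h v).map (A : V →ₗ[ℂ] V).toAddMonoidHom

theorem mul_right (A : Module.End ℂ V) (h : HasOpSum f T) : HasOpSum (fun i => f i * A) (T * A) :=
  fun v => h (A v)

theorem smul (c : ℂ) (h : HasOpSum f T) : HasOpSum (fun i => c • f i) (c • T) :=
  fun v => (h v).map (LinearMap.lsmul ℂ V c).toAddMonoidHom

theorem of_equiv (e : κ ≃ ι) (h : HasOpSum f T) : HasOpSum (fun k => f (e k)) T :=
  fun v => (h v).of_equiv e

theorem single (i : ι) (h : ∀ j, j ≠ i → f j = 0) : HasOpSum f (f i) :=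
  fun v => HasFinsum.single (f := fun i => f i v) i fun j hj => by rw [h j hj, LinearMap.zero_apply]

theorem of_scalar {c : ι → ℂ} {s : ℂ} (h : HasFinsum c s) (A : Module.End ℂ V) :
    HasOpSum (fun i => c i • A) (s • A) :=
  fun v => h.map ((LinearMap.lsmul ℂ V).flip (A v)).toAddMonoidHom

theorem prod_fiberwise {f : ι × κ → Module.End ℂ V} {g : ι → Module.End ℂ V} (h : HasOpSum f T)
    (hg : ∀ i, HasOpSum (fun k => f (i, k)) (g i)) : HasOpSum g T :=
  fun v => (h v).prod_fiberwise fun i => hg i v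

theorem mul {g : κ → Module.End ℂ V} (h : HasOpSum f T) (h' : HasOpSum g U) :
    HasOpSum (fun x : ι × κ => f x.1 * g x.2) (T * U) := by
  intro v
  -- Finitely many `k` survive on `v`, and for each of them finitely many `i` survive on `g k v`.
  have hfin : (Function.support fun x : ι × κ => (f x.1 * g x.2) v).Finite := by
    refine ((h' v).1.biUnion fun k _ => ((h (g k v)).1.image fun i => (i, k))).subset ?_
    rintro ⟨i, k⟩ hik
    simp only [Set.mem_iUnion]
    refine ⟨k, fun hk => hik ?_, i, hik, rfl⟩
    simp only at hk
    simp [hk]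
  have hs := HasFinsum.of_equiv (Equiv.prodComm κ ι)
    (⟨hfin, rfl⟩ : HasFinsum (fun x : ι × κ => (f x.1 * g x.2) v) _)
  have h2 := hs.prod_fiberwise (g := fun k => T (g k v)) fun k => h (g k v)
  have h3 := (h' v).map (T : V →ₗ[ℂ] V).toAddMonoidHom
  exact ⟨hfin, h2.unique h3⟩

/-- Gives a sum a name before its value is known; recursions or rearrangements then identify it. -/
theorem exists_of_finite (h : ∀ v, (Function.support fun i => f i v).Finite) :
    ∃ T, HasOpSum f T :=
  ⟨{ toFun := fun v => ∑ᶠ i, f i v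
     map_add' := fun v w => by simp only [map_add]; exact finsum_add_distrib (h v) (h w)
     map_smul' := fun c v => by
      simp only [map_smul, RingHom.id_apply]; exact (smul_finsum' c (h v)).symm },
    fun v => ⟨h v, rfl⟩⟩

theorem tensorOp {ν : ℕ} {f : ι → Module.End ℂ (SymAlg ν)} {T : Module.End ℂ (SymAlg ν)}
    (g : Module.End ℂ (GroupAlg ν)) (h : HasOpSum f T) :
    HasOpSum (fun i => tensorOp g (f i)) (tensorOp g T) := by
  intro v
  induction v using TensorProduct.induction_on with
  | zero => simpa using HasFinsum.zero
  | tmul x y => exact (h y).map (TensorProduct.mk ℂ _ _ (g x)).toAddMonoidHom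
  | add v w hv hw => simpa using hv.add hw

end HasOpSum

/-- The pointwise finite sum of a family of operators. -/
def opSum {ι V : Type*} [AddCommGroup V] [Module ℂ V] (f : ι → Module.End ℂ V) :
    Module.End ℂ V :=
  open Classical in if h : ∃ T, HasOpSum f T then h.choose else 0

theorem hasOpSum_opSum {ι V : Type*} [AddCommGroup V] [Module ℂ V] {f : ι → Module.End ℂ V}
    (h : ∀ v, (Function.support fun i => f i v).Finite) : HasOpSum f (opSum f) := by
  rw [opSum, dif_pos (HasOpSum.exists_of_finite h)]
  exact (HasOpSum.exists_of_finite h).choose_spec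

/-! ### Coefficients indexed by the integers -/

/-- The coefficients of a power series, extended by zero to negative indices. -/
def intCoeff {A : Type*} [Ring A] (f : PowerSeries A) (n : ℤ) : A :=
  if 0 ≤ n then PowerSeries.coeff n.toNat f else 0

theorem intCoeff_natCast {A : Type*} [Ring A] (f : PowerSeries A) (n : ℕ) :
    intCoeff f n = PowerSeries.coeff n f := by
  simp [intCoeff]

theorem intCoeff_of_neg {A : Type*} [Ring A] (f : PowerSeries A) {n : ℤ} (h : n < 0) :
    intCoeff f n = 0 := if_neg (by omega)

theorem intCoeff_one {A : Type*} [Ring A] (n : ℤ) :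
    intCoeff (1 : PowerSeries A) n = if n = 0 then 1 else 0 := by
  rcases lt_or_ge n 0 with h | h
  · rw [intCoeff_of_neg _ h, if_neg h.ne]
  · lift n to ℕ using h
    simp [intCoeff_natCast, PowerSeries.coeff_one]

/-- With coefficients indexed by ℤ, the Cauchy product becomes a sum over all of ℤ, so later shifts
of indices are bijections without boundary terms. -/
theorem hasOpSum_intCoeff_mul {V : Type*} [AddCommGroup V] [Module ℂ V]
    (A B : PowerSeries (Module.End ℂ V)) (s : ℤ) :
    HasOpSum (fun n : ℤ => intCoeff A (s - n) * intCoeff B n) (intCoeff (A * B) s) := by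
  intro v
  have hfin : (Function.support
      fun n : ℤ => (intCoeff A (s - n) * intCoeff B n) v).Finite := by
    refine (Set.finite_Icc 0 s).subset fun n hn => ?_
    by_contra hne
    rw [Set.mem_Icc, not_and_or, not_le, not_le] at hne
    refine hn ?_
    rcases hne with h | h
    · simp [intCoeff_of_neg B h]
    · simp [intCoeff_of_neg A (show s - n < 0 by omega)]
  refine ⟨hfin, ?_⟩
  rcases lt_or_ge s 0 with h | h
  · rw [intCoeff_of_neg _ h, LinearMap.zero_apply]
    refine finsum_eq_zero_of_forall_eq_zero fun n => ?_
    rcases lt_or_ge n 0 with h' | h'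
    · simp [intCoeff_of_neg B h']
    · simp [intCoeff_of_neg A (show s - n < 0 by omega)]
  · lift s to ℕ using h
    rw [finsum_eq_sum_of_support_subset (s := (Finset.range (s + 1)).map Nat.castEmbedding) _ ?_,
      Finset.sum_map, intCoeff_natCast, PowerSeries.coeff_mul,
      ← Finset.Nat.sum_antidiagonal_swap, LinearMap.sum_apply,
      Finset.Nat.sum_antidiagonal_eq_sum_range_succ_mk]
    · refine Finset.sum_congr rfl fun k hk => ?_
      have hk' : k ≤ s := by simpa [Nat.lt_succ_iff] using hk
      simp only [Nat.castEmbedding_apply, Prod.swap]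
      rw [← Nat.cast_sub hk', intCoeff_natCast, intCoeff_natCast]
    · intro n hn
      have h0 : 0 ≤ n := by
        by_contra h
        exact hn (by simp [intCoeff_of_neg B (not_le.mp h)])
      have h1 : n ≤ s := by
        by_contra h
        exact hn (by simp [intCoeff_of_neg A (show (s : ℤ) - n < 0 by omega)])
      lift n to ℕ using h0
      simp
      omega

/-- The pairs of naturals with difference `n` embed in ℤ through their second entry, and outside the
image one of the two factors is zero. -/
theorem hasOpSum_mixedCoeff {V : Type*} [AddCommGroup V] [Module ℂ V]
    (A B : PowerSeries (Module.End ℂ V)) (hB : LocallyFinite B) (n : ℤ) :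
    HasOpSum (fun s : ℤ => intCoeff A (n + s) * intCoeff B s) (mixedCoeff A B hB n) := by
  intro v
  have hfin : (Function.support fun s : ℤ => (intCoeff A (n + s) * intCoeff B s) v).Finite := by
    obtain ⟨N, hN⟩ := hB v
    refine (Set.finite_Icc (0 : ℤ) N).subset fun s hs => ?_
    have h0 : 0 ≤ s := by
      by_contra h
      exact hs (by simp [intCoeff_of_neg B (not_le.mp h)])
    refine ⟨h0, ?_⟩
    by_contra h
    lift s to ℕ using h0
    refine hs ?_
    simp only [Module.End.mul_apply]
    rw [intCoeff_natCast B, hN s (by omega), map_zero]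
  refine ⟨hfin, ?_⟩
  change _ = ∑ᶠ r : {r : ℕ × ℕ // (r.1 : ℤ) - r.2 = n},
      PowerSeries.coeff r.1.1 A (PowerSeries.coeff r.1.2 B v)
  set e : {r : ℕ × ℕ // (r.1 : ℤ) - r.2 = n} → ℤ := fun r => r.1.2
  have he : Function.Injective e := by
    rintro ⟨⟨p, q⟩, h⟩ ⟨⟨p', q'⟩, h'⟩ hqq
    simp only [e, Subtype.mk.injEq, Prod.mk.injEq] at h h' hqq ⊢
    omega
  rw [← finsum_mem_univ, ← finsum_mem_univ (fun r : {r : ℕ × ℕ // (r.1 : ℤ) - r.2 = n} => _)]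
  symm
  have hr : ∑ᶠ s ∈ Set.range e, (intCoeff A (n + s) * intCoeff B s) v =
      ∑ᶠ s ∈ Set.univ, (intCoeff A (n + s) * intCoeff B s) v := by
    refine finsum_mem_inter_support_eq _ _ _ ?_
    ext s
    simp only [Set.mem_inter_iff, Set.mem_univ, true_and, and_iff_right_iff_imp]
    intro hs
    have h0 : 0 ≤ s := by
      by_contra h
      exact hs (by simp [intCoeff_of_neg B (not_le.mp h)])
    have h1 : 0 ≤ n + s := by
      by_contra h
      exact hs (by simp [intCoeff_of_neg A (not_le.mp h)])
    exact ⟨⟨((n + s).toNat, s.toNat), by simp only; omega⟩, by simp only [e]; omega⟩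
  rw [← hr, finsum_mem_range he, finsum_mem_univ]
  refine finsum_congr fun r => ?_
  obtain ⟨⟨p, q⟩, h⟩ := r
  simp only at h
  simp only [e, Module.End.mul_apply]
  rw [intCoeff_natCast, show n + (q : ℤ) = p by omega, intCoeff_natCast]

/-! ### The Euler derivation and exponentials of power series -/

section Ring

variable {A : Type*} [Ring A]

/-- The Euler derivation `t d/dt` on power series. -/
def eulerDer (f : PowerSeries A) : PowerSeries A :=
  PowerSeries.mk fun n => (n : A) * PowerSeries.coeff n f

@[simp] theorem coeff_eulerDer (f : PowerSeries A) (n : ℕ) :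
    PowerSeries.coeff n (eulerDer f) = (n : A) * PowerSeries.coeff n f :=
  PowerSeries.coeff_mk _ _

theorem eulerDer_sub (f g : PowerSeries A) : eulerDer (f - g) = eulerDer f - eulerDer g := by
  ext n; simp [mul_sub]

theorem eulerDer_mul (f g : PowerSeries A) :
    eulerDer (f * g) = eulerDer f * g + f * eulerDer g := by
  ext n
  rw [coeff_eulerDer, map_add, PowerSeries.coeff_mul, PowerSeries.coeff_mul, PowerSeries.coeff_mul,
    Finset.mul_sum, ← Finset.sum_add_distrib]
  refine Finset.sum_congr rfl fun x hx => ?_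
  rw [Finset.HasAntidiagonal.mem_antidiagonal] at hx
  rw [coeff_eulerDer, coeff_eulerDer, ← hx, Nat.cast_add, add_mul, mul_assoc,
    ← mul_assoc (PowerSeries.coeff x.1 f), ← (Nat.cast_commute x.2 (PowerSeries.coeff x.1 f)).eq,
    mul_assoc]

theorem eulerDer_C (x : A) : eulerDer (PowerSeries.C x) = 0 := by
  ext n
  rw [coeff_eulerDer, PowerSeries.coeff_C]
  split_ifs with h <;> simp [h]

theorem eulerDer_pow {f : PowerSeries A} (h : Commute (eulerDer f) f) (l : ℕ) :
    eulerDer (f ^ (l + 1)) = (l + 1 : ℕ) • (eulerDer f * f ^ l) := by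
  induction l with
  | zero => simp
  | succ l ih =>
    rw [pow_succ, eulerDer_mul, ih, smul_mul_assoc, mul_assoc, ← pow_succ,
      ← (h.pow_right (l + 1)).eq, succ_nsmul _ (l + 1)]

/-- Power series whose coefficients commute pairwise commute. -/
theorem commute_of_coeff {f g : PowerSeries A}
    (h : ∀ m n, Commute (PowerSeries.coeff m f) (PowerSeries.coeff n g)) : Commute f g := by
  ext n
  rw [PowerSeries.coeff_mul, PowerSeries.coeff_mul, ← Finset.Nat.sum_antidiagonal_swap]
  exact Finset.sum_congr rfl fun x _ => h _ _

theorem commute_coeff_pow {x : A} {f : PowerSeries A}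
    (h : ∀ n, Commute x (PowerSeries.coeff n f)) (l n : ℕ) :
    Commute x (PowerSeries.coeff n (f ^ l)) := by
  induction l generalizing n with
  | zero =>
    rw [pow_zero, PowerSeries.coeff_one]
    split_ifs
    exacts [Commute.one_right x, Commute.zero_right x]
  | succ l ih =>
    rw [pow_succ, PowerSeries.coeff_mul]
    exact Commute.sum_right _ _ _ fun y _ => (ih _).mul_right (h _)

theorem coeff_pow_of_lt {f : PowerSeries A} (h : PowerSeries.coeff 0 f = 0) {l n : ℕ}
    (hn : n < l) : PowerSeries.coeff n (f ^ l) = 0 := by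
  induction l generalizing n with
  | zero => omega
  | succ l ih =>
    rw [pow_succ, PowerSeries.coeff_mul]
    refine Finset.sum_eq_zero fun x hx => ?_
    rw [Finset.HasAntidiagonal.mem_antidiagonal] at hx
    by_cases h2 : x.2 = 0
    · rw [h2, h, mul_zero]
    · rw [ih (by omega), zero_mul]

end Ring

section Algebra

variable {A : Type*} [Ring A] [Algebra ℂ A]

theorem coeff_zero_expSeries (f : PowerSeries A) : PowerSeries.coeff 0 (expSeries f) = 1 := by
  simp [expSeries]

theorem commute_coeff_expSeries {x : A} {f : PowerSeries A}
    (h : ∀ n, Commute x (PowerSeries.coeff n f)) (n : ℕ) :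
    Commute x (PowerSeries.coeff n (expSeries f)) := by
  rw [expSeries, PowerSeries.coeff_mk]
  exact Commute.sum_right _ _ _ fun l _ => (commute_coeff_pow h l n).smul_right _

theorem commute_coeff_expSeries_expSeries {f g : PowerSeries A}
    (h : ∀ m n, Commute (PowerSeries.coeff m f) (PowerSeries.coeff n g)) (m n : ℕ) :
    Commute (PowerSeries.coeff m (expSeries f)) (PowerSeries.coeff n (expSeries g)) :=
  commute_coeff_expSeries (fun n => (commute_coeff_expSeries (fun m => (h m n).symm) m).symm) n

theorem coeff_pow_scale {f g : PowerSeries A} {c : ℂ}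
    (h : ∀ n, PowerSeries.coeff n g = c ^ n • PowerSeries.coeff n f) (l n : ℕ) :
    PowerSeries.coeff n (g ^ l) = c ^ n • PowerSeries.coeff n (f ^ l) := by
  induction l generalizing n with
  | zero =>
    rw [pow_zero, pow_zero, PowerSeries.coeff_one]
    split_ifs with hn <;> simp [hn]
  | succ l ih =>
    rw [pow_succ, pow_succ, PowerSeries.coeff_mul, PowerSeries.coeff_mul, Finset.smul_sum]
    refine Finset.sum_congr rfl fun x hx => ?_
    rw [Finset.HasAntidiagonal.mem_antidiagonal] at hx
    rw [ih, h, smul_mul_smul_comm, ← pow_add, hx]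

theorem coeff_expSeries_scale {f g : PowerSeries A} {c : ℂ}
    (h : ∀ n, PowerSeries.coeff n g = c ^ n • PowerSeries.coeff n f) (n : ℕ) :
    PowerSeries.coeff n (expSeries g) = c ^ n • PowerSeries.coeff n (expSeries f) := by
  simp only [expSeries, PowerSeries.coeff_mk, Finset.smul_sum]
  refine Finset.sum_congr rfl fun l _ => ?_
  rw [coeff_pow_scale h, smul_comm]

/-- Without constant term, `f ^ l` starts in degree `l`, so one cutoff serves several coefficients
at once. -/
theorem coeff_expSeries_eq_sum {f : PowerSeries A} (h0 : PowerSeries.coeff 0 f = 0) {n N : ℕ}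
    (h : n ≤ N) : PowerSeries.coeff n (expSeries f) =
      ∑ l ∈ Finset.range (N + 1), ((l.factorial : ℂ)⁻¹) • PowerSeries.coeff n (f ^ l) := by
  rw [expSeries, PowerSeries.coeff_mk]
  refine Finset.sum_subset (Finset.range_mono (by omega)) fun l _ hl => ?_
  rw [Finset.mem_range, not_lt] at hl
  rw [coeff_pow_of_lt h0 (by omega), smul_zero]

/-- The exponential of a series with commuting coefficients solves the obvious differential
equation. -/
theorem eulerDer_expSeries {f : PowerSeries A} (h0 : PowerSeries.coeff 0 f = 0)
    (h : Commute (eulerDer f) f) : eulerDer (expSeries f) = eulerDer f * expSeries f := by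
  ext n
  have h1 : ∀ l, (n : A) * PowerSeries.coeff n (f ^ (l + 1)) =
      ((l + 1 : ℕ) : ℂ) • PowerSeries.coeff n (eulerDer f * f ^ l) := fun l => by
    rw [← coeff_eulerDer, eulerDer_pow h, map_nsmul, Nat.cast_smul_eq_nsmul]
  -- The cutoff is one larger than necessary, so that splitting off `l = 0` leaves the same range as
  -- on the right-hand side.
  rw [coeff_eulerDer, coeff_expSeries_eq_sum h0 (Nat.le_succ n), Finset.mul_sum,
    Finset.sum_range_succ', PowerSeries.coeff_mul]
  have h2 : ∀ x ∈ Finset.HasAntidiagonal.antidiagonal n,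
      PowerSeries.coeff x.1 (eulerDer f) * PowerSeries.coeff x.2 (expSeries f) =
        ∑ l ∈ Finset.range (n + 1), ((l.factorial : ℂ)⁻¹) •
          (PowerSeries.coeff x.1 (eulerDer f) * PowerSeries.coeff x.2 (f ^ l)) := fun x hx => by
    rw [coeff_expSeries_eq_sum (N := n) h0 (by
      rw [Finset.HasAntidiagonal.mem_antidiagonal] at hx; omega), Finset.mul_sum]
    exact Finset.sum_congr rfl fun l _ => mul_smul_comm _ _ _
  rw [Finset.sum_congr rfl h2, Finset.sum_comm]
  have h3 : (n : A) * (((Nat.factorial 0 : ℕ) : ℂ)⁻¹ • PowerSeries.coeff n (f ^ 0)) = 0 := by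
    rw [pow_zero, PowerSeries.coeff_one]
    split_ifs with hn <;> simp [hn]
  rw [h3, add_zero]
  refine Finset.sum_congr rfl fun l _ => ?_
  rw [mul_smul_comm, h1, smul_smul, ← Finset.smul_sum, ← PowerSeries.coeff_mul]
  congr 1
  rw [Nat.factorial_succ, Nat.cast_mul, mul_inv, mul_comm, ← mul_assoc,
    mul_inv_cancel₀ (Nat.cast_ne_zero.mpr l.succ_ne_zero), one_mul]

/-- Uniqueness for the equation `t dY/dt = K Y`. -/
theorem eq_zero_of_eulerDer_eq {K Y : PowerSeries A} (hK : PowerSeries.coeff 0 K = 0)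
    (hY : PowerSeries.coeff 0 Y = 0) (h : eulerDer Y = K * Y) : Y = 0 := by
  ext n
  rw [map_zero]
  induction n using Nat.strong_induction_on with
  | _ n ih =>
    rcases Nat.eq_zero_or_pos n with rfl | hn
    · exact hY
    have h1 : PowerSeries.coeff n (eulerDer Y) = 0 := by
      rw [h, PowerSeries.coeff_mul]
      refine Finset.sum_eq_zero fun x hx => ?_
      rw [Finset.HasAntidiagonal.mem_antidiagonal] at hx
      by_cases h2 : x.1 = 0
      · rw [h2, hK, zero_mul]
      · rw [ih _ (by omega), mul_zero]
    -- The factor `n` is turned into a complex scalar, which can be cancelled.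
    rw [coeff_eulerDer, ← Nat.cast_smul_eq_nsmul ℂ n (1 : A) |>.trans (nsmul_one n),
      smul_mul_assoc, one_mul] at h1
    exact (smul_eq_zero.mp h1).resolve_left (Nat.cast_ne_zero.mpr hn.ne')

theorem eq_of_eulerDer_eq {K Y Z : PowerSeries A} (hK : PowerSeries.coeff 0 K = 0)
    (h0 : PowerSeries.coeff 0 Y = PowerSeries.coeff 0 Z) (hY : eulerDer Y = K * Y)
    (hZ : eulerDer Z = K * Z) : Y = Z := by
  refine sub_eq_zero.mp (eq_zero_of_eulerDer_eq hK (by rw [map_sub, h0, sub_self]) ?_)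
  rw [eulerDer_sub, hY, hZ, mul_sub]

end Algebra

/-! ### Exchange of two exponentials of Heisenberg modes -/

/-- The coefficients of `(1 - x) / (1 + x)`. -/
def exchangeCoeff (k : ℕ) : ℂ := if k = 0 then 1 else 2 * (-1) ^ k

/-- For φ = (1 - x)/(1 + x) the logarithmic derivative x φ'/φ is -2x/(1 - x²), the sum of -2 x^r
over odd `r`; this is x φ' = (x φ'/φ) φ read off coefficientwise. -/
theorem sum_exchangeCoeff (m : ℕ) :
    ∑ x ∈ Finset.HasAntidiagonal.antidiagonal m, (if Odd x.1 then (-2 : ℂ) else 0) * exchangeCoeff x.2 =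
      m * exchangeCoeff m := by
  have step : ∀ m, ∑ x ∈ Finset.HasAntidiagonal.antidiagonal (m + 2),
      (if Odd x.1 then (-2 : ℂ) else 0) * exchangeCoeff x.2 =
      -2 * exchangeCoeff (m + 1) + ∑ x ∈ Finset.HasAntidiagonal.antidiagonal m,
      (if Odd x.1 then (-2 : ℂ) else 0) * exchangeCoeff x.2 := by
    intro m
    rw [Finset.Nat.sum_antidiagonal_succ, Finset.Nat.sum_antidiagonal_succ]
    simp [Nat.odd_add_one]
  induction m using Nat.twoStepInduction with
  | zero => simp
  | one => simp [Finset.Nat.antidiagonal_succ, exchangeCoeff]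
  | more m ih _ =>
    rw [step, ih]
    rcases Nat.eq_zero_or_pos m with rfl | hm
    · simp [exchangeCoeff]
    · simp only [exchangeCoeff, hm.ne', if_false, Nat.add_eq_zero_iff, one_ne_zero, and_false,
        OfNat.ofNat_ne_zero, pow_add]
      push_cast
      ring

section Exchange

variable {A : Type*} [Ring A] [Algebra ℂ A] {H K E F : PowerSeries A}

/-- If `[K_r, H_s] = -2 r δ_rs` for odd `r` and `0` for even `r`, and `E` is the exponential with
logarithmic derivative `H`, then `[K_r, E_p] = -2 E_(p-r)` for odd `r`. -/
theorem commutator_coeff (hH0 : PowerSeries.coeff 0 H = 0)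
    (hE0 : PowerSeries.coeff 0 E = 1) (hE : eulerDer E = H * E)
    (hKH : ∀ r s, PowerSeries.coeff r K * PowerSeries.coeff s H -
      PowerSeries.coeff s H * PowerSeries.coeff r K =
        algebraMap ℂ A (if Odd r ∧ r = s then -2 * (r : ℂ) else 0)) (r : ℕ) :
    PowerSeries.C (PowerSeries.coeff r K) * E - E * PowerSeries.C (PowerSeries.coeff r K) =
      PowerSeries.C (algebraMap ℂ A (if Odd r then -2 else 0)) * (PowerSeries.X ^ r * E) := by
  have hC : PowerSeries.C (PowerSeries.coeff r K) * H =
      H * PowerSeries.C (PowerSeries.coeff r K) +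
        PowerSeries.C (algebraMap ℂ A (if Odd r then -2 * (r : ℂ) else 0)) *
          PowerSeries.X ^ r := by
    ext s
    rw [map_add, PowerSeries.coeff_C_mul, PowerSeries.coeff_mul_C, PowerSeries.coeff_C_mul,
      ← sub_eq_iff_eq_add', hKH, PowerSeries.coeff_X_pow]
    by_cases h1 : Odd r <;> by_cases h2 : r = s <;> simp [h1, h2, eq_comm]
  have hX : eulerDer (PowerSeries.X ^ r : PowerSeries A) =
      PowerSeries.C (r : A) * PowerSeries.X ^ r := by
    ext s
    rw [coeff_eulerDer, PowerSeries.coeff_C_mul, PowerSeries.coeff_X_pow]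
    split_ifs with h <;> simp [h]
  have hcomm : ∀ (c : ℂ) (f : PowerSeries A), f * PowerSeries.C (algebraMap ℂ A c) =
      PowerSeries.C (algebraMap ℂ A c) * f := fun c f => by
    ext s
    rw [PowerSeries.coeff_C_mul, PowerSeries.coeff_mul_C, Algebra.commutes]
  have hE1 : PowerSeries.constantCoeff E = 1 := by simpa using hE0
  -- The difference Y of the two sides solves t dY/dt = H Y: the term from [K_r, H] cancels against
  -- the derivative of X^r.
  refine sub_eq_zero.mp (eq_zero_of_eulerDer_eq hH0 ?_ ?_)
  · by_cases hr : Odd r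
    · have : r ≠ 0 := by rintro rfl; simp at hr
      simp [hE1, this]
    · simp [hE1, hr]
  · rw [eulerDer_sub, eulerDer_sub, eulerDer_mul, eulerDer_mul, eulerDer_mul, eulerDer_mul,
      eulerDer_C, eulerDer_C, hE, hX, ← mul_assoc (PowerSeries.C (PowerSeries.coeff r K)), hC]
    have h3 : PowerSeries.C (algebraMap ℂ A (if Odd r then -2 * (r : ℂ) else 0)) =
        PowerSeries.C (algebraMap ℂ A (if Odd r then -2 else 0)) * PowerSeries.C (r : A) := by
      rw [← map_mul]
      congr 1
      split_ifs <;> simp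
    rw [h3]
    have h4 : PowerSeries.X ^ r * (H * E) = H * (PowerSeries.X ^ r * E) := by
      rw [← mul_assoc, ← mul_assoc, (PowerSeries.commute_X_pow H r).eq]
    have h5 := hcomm (if Odd r then -2 else 0) H
    rw [h4, mul_add, ← mul_assoc _ H, ← h5]
    noncomm_ring

/-- `F E = (1 - x) / (1 + x) E F`, coefficientwise, for exponentials `E`, `F` of Heisenberg
modes. -/
theorem mul_C_coeff_eq (hH0 : PowerSeries.coeff 0 H = 0) (hK0 : PowerSeries.coeff 0 K = 0)
    (hE0 : PowerSeries.coeff 0 E = 1) (hE : eulerDer E = H * E)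
    (hF0 : PowerSeries.coeff 0 F = 1) (hF : eulerDer F = K * F)
    (hKH : ∀ r s, PowerSeries.coeff r K * PowerSeries.coeff s H -
      PowerSeries.coeff s H * PowerSeries.coeff r K =
        algebraMap ℂ A (if Odd r ∧ r = s then -2 * (r : ℂ) else 0)) (p : ℤ) :
    F * PowerSeries.C (intCoeff E p) =
      PowerSeries.mk (fun k => exchangeCoeff k • intCoeff E (p - k)) * F := by
  set U : PowerSeries A := PowerSeries.mk fun k => exchangeCoeff k • intCoeff E (p - k) with hU
  have hcomm : ∀ (r : ℕ) (q : ℤ), PowerSeries.coeff r K * intCoeff E q =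
      intCoeff E q * PowerSeries.coeff r K +
        (if Odd r then (-2 : ℂ) else 0) • intCoeff E (q - r) := by
    intro r q
    rcases lt_or_ge q 0 with h | h
    · rw [intCoeff_of_neg E h, intCoeff_of_neg E (by omega)]
      simp
    · lift q to ℕ using h
      have := congrArg (PowerSeries.coeff q) (commutator_coeff hH0 hE0 hE hKH r)
      rw [map_sub, PowerSeries.coeff_C_mul, PowerSeries.coeff_mul_C, PowerSeries.coeff_C_mul,
        PowerSeries.coeff_X_pow_mul', sub_eq_iff_eq_add', ← Algebra.smul_def] at this
      rw [intCoeff_natCast, this]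
      congr 2
      split_ifs with h
      · rw [← Nat.cast_sub h, intCoeff_natCast]
      · rw [intCoeff_of_neg E (by omega)]
  -- In degree `m` every commutator is a multiple of the same coefficient E_(p-m), so this reduces
  -- to the scalar equation `sum_exchangeCoeff`.
  have hKU : K * U = U * K + eulerDer U := by
    ext m
    rw [map_add, PowerSeries.coeff_mul m U K, ← Finset.Nat.sum_antidiagonal_swap (n := m),
      PowerSeries.coeff_mul, coeff_eulerDer, ← sub_eq_iff_eq_add',
      ← Finset.sum_sub_distrib]
    have : ∀ x ∈ Finset.HasAntidiagonal.antidiagonal m, PowerSeries.coeff x.1 K * PowerSeries.coeff x.2 U -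
        PowerSeries.coeff x.swap.1 U * PowerSeries.coeff x.swap.2 K =
        ((if Odd x.1 then (-2 : ℂ) else 0) * exchangeCoeff x.2) • intCoeff E (p - m) := by
      intro x hx
      rw [Finset.HasAntidiagonal.mem_antidiagonal] at hx
      rw [Prod.fst_swap, Prod.snd_swap, hU, PowerSeries.coeff_mk, mul_smul_comm, smul_mul_assoc,
        hcomm, ← smul_sub, add_sub_cancel_left, smul_smul, mul_comm]
      congr 2
      omega
    rw [Finset.sum_congr rfl this, ← Finset.sum_smul, sum_exchangeCoeff, hU,
      PowerSeries.coeff_mk, mul_smul, Nat.cast_smul_eq_nsmul, nsmul_eq_mul]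
  -- Both sides solve t dY/dt = K Y with constant term E_p; for the right side this is `hKU`.
  refine eq_of_eulerDer_eq hK0 ?_ ?_ ?_
  · simp [PowerSeries.coeff_mul, hF0, hU, exchangeCoeff]
  · rw [eulerDer_mul, eulerDer_C, hF, mul_zero, add_zero, mul_assoc]
  · rw [eulerDer_mul, hF, ← mul_assoc, ← mul_assoc, hKU, add_mul, add_comm]

/-- Multiplying by 1 + x turns the infinite tail of (1 - x)/(1 + x) into 1 - x, so only two terms
remain on each side. -/
theorem exchange_intCoeff (hH0 : PowerSeries.coeff 0 H = 0) (hK0 : PowerSeries.coeff 0 K = 0)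
    (hE0 : PowerSeries.coeff 0 E = 1) (hE : eulerDer E = H * E)
    (hF0 : PowerSeries.coeff 0 F = 1) (hF : eulerDer F = K * F)
    (hKH : ∀ r s, PowerSeries.coeff r K * PowerSeries.coeff s H -
      PowerSeries.coeff s H * PowerSeries.coeff r K =
        algebraMap ℂ A (if Odd r ∧ r = s then -2 * (r : ℂ) else 0)) (q p : ℤ) :
    intCoeff F q * intCoeff E p + intCoeff F (q - 1) * intCoeff E (p - 1) =
      intCoeff E p * intCoeff F q - intCoeff E (p - 1) * intCoeff F (q - 1) := by
  have key : F * PowerSeries.C (intCoeff E p) +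
      PowerSeries.X * (F * PowerSeries.C (intCoeff E (p - 1))) =
      PowerSeries.C (intCoeff E p) * F -
        PowerSeries.X * (PowerSeries.C (intCoeff E (p - 1)) * F) := by
    rw [mul_C_coeff_eq hH0 hK0 hE0 hE hF0 hF hKH, mul_C_coeff_eq hH0 hK0 hE0 hE hF0 hF hKH,
      ← mul_assoc, ← mul_assoc, ← add_mul, ← sub_mul]
    congr 1
    ext n
    cases n with
    | zero => simp [exchangeCoeff]
    | succ n =>
      rw [map_add, map_sub, PowerSeries.coeff_succ_X_mul, PowerSeries.coeff_succ_X_mul,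
        PowerSeries.coeff_mk, PowerSeries.coeff_mk, PowerSeries.coeff_C, PowerSeries.coeff_C,
        if_neg n.succ_ne_zero, show p - ((n + 1 : ℕ) : ℤ) = p - 1 - n by push_cast; ring,
        ← add_smul]
      -- The first two exchange coefficients add to -1, the numerator term -x; all later consecutive
      -- ones cancel.
      by_cases hn : n = 0
      · subst hn
        simp [exchangeCoeff]
        rw [show (-2 + 1 : ℂ) = -1 by norm_num, neg_one_smul]
      · rw [if_neg hn, sub_zero]
        simp only [exchangeCoeff, hn, n.succ_ne_zero, if_false]
        rw [pow_succ, ← mul_add]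
        simp
  rcases lt_or_ge q 0 with h | h
  · simp [intCoeff_of_neg F h, intCoeff_of_neg F (show q - 1 < 0 by omega)]
  lift q to ℕ using h
  have := congrArg (PowerSeries.coeff q) key
  rw [map_add, map_sub, PowerSeries.coeff_mul_C, PowerSeries.coeff_C_mul] at this
  cases q with
  | zero =>
    simp only [intCoeff_natCast, intCoeff_of_neg F (show ((0 : ℕ) : ℤ) - 1 < 0 by omega)]
    simpa using this
  | succ q =>
    rw [PowerSeries.coeff_succ_X_mul, PowerSeries.coeff_succ_X_mul, PowerSeries.coeff_mul_C,
      PowerSeries.coeff_C_mul] at this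
    rw [show ((q + 1 : ℕ) : ℤ) - 1 = q by push_cast; ring, intCoeff_natCast, intCoeff_natCast]
    exact this

end Exchange

/-! ### The Heisenberg relations -/

section Modes

variable {ν : ℕ}

theorem basisMode_of_not_odd (i : Fin ν) {n : ℤ} (h : ¬ Odd n.natAbs) : basisMode i n = 0 :=
  dif_neg h

theorem basisMode_natCast (i : Fin ν) {r : ℕ} (h : Odd r) :
    basisMode i (r : ℤ) =
      ((r : ℂ) / 2) • (MvPolynomial.pderiv (R := ℂ) (i, ⟨r, h⟩)).toLinearMap := by
  have hr := h.pos
  rw [basisMode, dif_pos (by simpa using h), if_pos (by omega)]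
  simp

theorem basisMode_neg_natCast (i : Fin ν) {r : ℕ} (h : Odd r) :
    basisMode i (-(r : ℤ)) = LinearMap.mulLeft ℂ (MvPolynomial.X (i, ⟨r, h⟩)) := by
  rw [basisMode, dif_pos (by simpa using h), if_neg (by omega)]
  simp

theorem commute_basisMode_neg (i j : Fin ν) (r s : ℕ) :
    Commute (basisMode i (-(r : ℤ))) (basisMode j (-(s : ℤ))) := by
  by_cases hr : Odd r
  · by_cases hs : Odd s
    · rw [basisMode_neg_natCast i hr, basisMode_neg_natCast j hs]
      exact LinearMap.ext fun v => mul_left_comm _ _ _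
    · rw [basisMode_of_not_odd j (by simpa using hs)]
      exact Commute.zero_right _
  · rw [basisMode_of_not_odd i (by simpa using hr)]
    exact Commute.zero_left _

/-- The commutator of two derivations is a derivation, and this one kills every variable. -/
theorem pderiv_comm {σ R : Type*} [CommRing R] (x y : σ) (v : MvPolynomial σ R) :
    MvPolynomial.pderiv x (MvPolynomial.pderiv y v) =
      MvPolynomial.pderiv y (MvPolynomial.pderiv x v) := by
  classical
  have h : ⁅MvPolynomial.pderiv (R := R) x, MvPolynomial.pderiv y⁆ = 0 :=
    MvPolynomial.derivation_ext fun z => by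
      rw [Derivation.commutator_apply, MvPolynomial.pderiv_X, MvPolynomial.pderiv_X]
      simp only [Pi.single_apply]
      split_ifs <;> simp
  have := DFunLike.congr_fun h v
  rwa [Derivation.commutator_apply, Derivation.zero_apply, sub_eq_zero] at this

theorem commute_basisMode (i j : Fin ν) (r s : ℕ) :
    Commute (basisMode i (r : ℤ)) (basisMode j (s : ℤ)) := by
  by_cases hr : Odd r
  · by_cases hs : Odd s
    · rw [basisMode_natCast i hr, basisMode_natCast j hs]
      refine Commute.smul_left (Commute.smul_right ?_ _) _
      exact LinearMap.ext fun v => pderiv_comm _ _ _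
    · rw [basisMode_of_not_odd j (by simpa using hs)]
      exact Commute.zero_right _
  · rw [basisMode_of_not_odd i (by simpa using hr)]
    exact Commute.zero_left _

theorem basisMode_commutator (i j : Fin ν) (r s : ℕ) :
    basisMode i (r : ℤ) * basisMode j (-(s : ℤ)) - basisMode j (-(s : ℤ)) * basisMode i (r : ℤ) =
      algebraMap ℂ _ (if i = j ∧ Odd r ∧ r = s then (r : ℂ) / 2 else 0) := by
  classical
  by_cases hr : Odd r
  · by_cases hs : Odd s
    · rw [basisMode_natCast i hr, basisMode_neg_natCast j hs]
      refine LinearMap.ext fun v => ?_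
      simp only [smul_mul_assoc, mul_smul_comm, LinearMap.sub_apply, LinearMap.smul_apply,
        Module.End.mul_apply, LinearMap.mulLeft_apply, Derivation.coeFn_coe, Derivation.leibniz,
        MvPolynomial.pderiv_X, Module.algebraMap_end_apply, Pi.single_apply, Prod.mk.injEq,
        Subtype.mk.injEq, smul_eq_mul, hr, true_and]
      by_cases h1 : i = j <;> by_cases h2 : r = s <;>
        simp [h1, h2, eq_comm (a := j), eq_comm (a := s)]
    · rw [basisMode_of_not_odd j (n := -(s : ℤ)) (by simpa using hs), if_neg]
      · simp
      · rintro ⟨_, h, rfl⟩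
        exact hs h
  · rw [basisMode_of_not_odd i (n := (r : ℤ)) (by simpa using hr), if_neg fun h => hr h.2.1]
    simp

end Modes

/-! ### Exponentials of Heisenberg modes -/

section Exponentials

variable {ι V : Type*} [DecidableEq ι] [AddCommGroup V] [Module ℂ V]

/-- The relations `[β_i(m), β_j(n)] = (m/2) δ_ij δ_(m+n,0)` of the Heisenberg algebra spanned by the
`β_i(n)`, `n` odd; the `β_i(n)` with `n` even vanish. -/
structure IsHeisenberg (β : ι → ℤ → Module.End ℂ V) : Prop where
  eq_zero (i : ι) (n : ℤ) : ¬ Odd n.natAbs → β i n = 0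
  commute_neg (i j : ι) (r s : ℕ) : Commute (β i (-(r : ℤ))) (β j (-(s : ℤ)))
  commute_pos (i j : ι) (r s : ℕ) : Commute (β i (r : ℤ)) (β j (s : ℤ))
  commutator (i j : ι) (r s : ℕ) :
    β i (r : ℤ) * β j (-(s : ℤ)) - β j (-(s : ℤ)) * β i (r : ℤ) =
      algebraMap ℂ _ (if i = j ∧ Odd r ∧ r = s then (r : ℂ) / 2 else 0)

/-- The series `∑ (2/k) β(-k) (cz)^k`. -/
def logMinus (β : ℤ → Module.End ℂ V) (c : ℂˣ) : PowerSeries (Module.End ℂ V) :=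
  PowerSeries.mk fun k => (2 / (k : ℂ) * (c : ℂ) ^ k) • β (-(k : ℤ))

/-- The series `-∑ (2/k) β(k) (cz)^(-k)`, as a power series in `z⁻¹`. -/
def logPlus (β : ℤ → Module.End ℂ V) (c : ℂˣ) : PowerSeries (Module.End ℂ V) :=
  PowerSeries.mk fun k => (-2 / (k : ℂ) * (c : ℂ)⁻¹ ^ k) • β (k : ℤ)

/-- The exponential of the creation part. -/
def expMinus (β : ℤ → Module.End ℂ V) (c : ℂˣ) : PowerSeries (Module.End ℂ V) :=
  expSeries (logMinus β c)

/-- The exponential of the annihilation part. -/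
def expPlus (β : ℤ → Module.End ℂ V) (c : ℂˣ) : PowerSeries (Module.End ℂ V) :=
  expSeries (logPlus β c)

theorem coeff_logMinus (β : ℤ → Module.End ℂ V) (c : ℂˣ) (k : ℕ) :
    PowerSeries.coeff k (logMinus β c) = (2 / (k : ℂ) * (c : ℂ) ^ k) • β (-(k : ℤ)) :=
  PowerSeries.coeff_mk _ _

theorem coeff_logPlus (β : ℤ → Module.End ℂ V) (c : ℂˣ) (k : ℕ) :
    PowerSeries.coeff k (logPlus β c) = (-2 / (k : ℂ) * (c : ℂ)⁻¹ ^ k) • β (k : ℤ) :=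
  PowerSeries.coeff_mk _ _

theorem coeff_zero_logMinus (β : ℤ → Module.End ℂ V) (c : ℂˣ) :
    PowerSeries.coeff 0 (logMinus β c) = 0 := by
  rw [coeff_logMinus]; simp

theorem coeff_zero_logPlus (β : ℤ → Module.End ℂ V) (c : ℂˣ) :
    PowerSeries.coeff 0 (logPlus β c) = 0 := by
  rw [coeff_logPlus]; simp

/-- Replacing z by cz multiplies the coefficient of z^n by c^n; this transfers sums at general `c`
to the modes at `c = 1`. -/
theorem intCoeff_expMinus (β : ℤ → Module.End ℂ V) (c : ℂˣ) (n : ℤ) :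
    intCoeff (expMinus β c) n = (c : ℂ) ^ n • intCoeff (expMinus β 1) n := by
  rcases lt_or_ge n 0 with h | h
  · simp [intCoeff_of_neg _ h]
  · lift n to ℕ using h
    rw [intCoeff_natCast, intCoeff_natCast, zpow_natCast]
    refine coeff_expSeries_scale (fun k => ?_) n
    rw [coeff_logMinus, coeff_logMinus, smul_smul]
    congr 1
    simp
    ring

theorem intCoeff_expPlus (β : ℤ → Module.End ℂ V) (c : ℂˣ) (n : ℤ) :
    intCoeff (expPlus β c) n = (c : ℂ) ^ (-n) • intCoeff (expPlus β 1) n := by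
  rcases lt_or_ge n 0 with h | h
  · simp [intCoeff_of_neg _ h]
  · lift n to ℕ using h
    rw [intCoeff_natCast, intCoeff_natCast, zpow_neg, zpow_natCast, ← inv_pow]
    refine coeff_expSeries_scale (fun k => ?_) n
    rw [coeff_logPlus, coeff_logPlus, smul_smul]
    congr 1
    simp
    ring

theorem commute_eulerDer {A : Type*} [Ring A] {f g : PowerSeries A}
    (h : ∀ m n, Commute (PowerSeries.coeff m f) (PowerSeries.coeff n g)) :
    Commute (eulerDer f) g :=
  commute_of_coeff fun m n => by
    rw [coeff_eulerDer]
    exact (Nat.cast_commute m _).mul_left (h m n)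

theorem commute_intCoeff {A : Type*} [Ring A] {f g : PowerSeries A}
    (h : ∀ m n, Commute (PowerSeries.coeff m f) (PowerSeries.coeff n g)) (m n : ℤ) :
    Commute (intCoeff f m) (intCoeff g n) := by
  rw [intCoeff, intCoeff]
  split_ifs
  exacts [h _ _, Commute.zero_right _, Commute.zero_left _, Commute.zero_left _]

/-! ### Logarithmic derivatives, exchange relation and inverses -/

namespace IsHeisenberg

variable {β : ι → ℤ → Module.End ℂ V} (hβ : IsHeisenberg β)
include hβ

theorem apply_zero (i : ι) : β i 0 = 0 := hβ.eq_zero i 0 (by simp)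

theorem coeff_eulerDer_logMinus (i : ι) (c : ℂˣ) (k : ℕ) :
    PowerSeries.coeff k (eulerDer (logMinus (β i) c)) = (2 * (c : ℂ) ^ k) • β i (-(k : ℤ)) := by
  rw [coeff_eulerDer, coeff_logMinus]
  rcases Nat.eq_zero_or_pos k with rfl | hk
  · simp [hβ.apply_zero]
  · have : (k : ℂ) ≠ 0 := Nat.cast_ne_zero.mpr hk.ne'
    rw [← nsmul_eq_mul, ← Nat.cast_smul_eq_nsmul ℂ, smul_smul]
    congr 1
    field_simp

theorem coeff_eulerDer_logPlus (i : ι) (c : ℂˣ) (k : ℕ) :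
    PowerSeries.coeff k (eulerDer (logPlus (β i) c)) = (-2 * (c : ℂ)⁻¹ ^ k) • β i (k : ℤ) := by
  rw [coeff_eulerDer, coeff_logPlus]
  rcases Nat.eq_zero_or_pos k with rfl | hk
  · simp [hβ.apply_zero]
  · have : (k : ℂ) ≠ 0 := Nat.cast_ne_zero.mpr hk.ne'
    rw [← nsmul_eq_mul, ← Nat.cast_smul_eq_nsmul ℂ, smul_smul]
    congr 1
    field_simp

theorem commute_coeff_logMinus (i j : ι) (c d : ℂˣ) (m n : ℕ) :
    Commute (PowerSeries.coeff m (logMinus (β i) c)) (PowerSeries.coeff n (logMinus (β j) d)) := by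
  rw [coeff_logMinus, coeff_logMinus]
  exact ((hβ.commute_neg i j m n).smul_right _).smul_left _

theorem commute_coeff_logPlus (i j : ι) (c d : ℂˣ) (m n : ℕ) :
    Commute (PowerSeries.coeff m (logPlus (β i) c)) (PowerSeries.coeff n (logPlus (β j) d)) := by
  rw [coeff_logPlus, coeff_logPlus]
  exact ((hβ.commute_pos i j m n).smul_right _).smul_left _

theorem eulerDer_expMinus (i : ι) (c : ℂˣ) :
    eulerDer (expMinus (β i) c) = eulerDer (logMinus (β i) c) * expMinus (β i) c :=
  eulerDer_expSeries (coeff_zero_logMinus (β i) c)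
    (commute_eulerDer (hβ.commute_coeff_logMinus i i c c))

theorem eulerDer_expPlus (i : ι) (c : ℂˣ) :
    eulerDer (expPlus (β i) c) = eulerDer (logPlus (β i) c) * expPlus (β i) c :=
  eulerDer_expSeries (coeff_zero_logPlus (β i) c)
    (commute_eulerDer (hβ.commute_coeff_logPlus i i c c))

/-- Only odd modes are nonzero, so z ↦ -z changes the sign of every term. -/
theorem neg_pow_smul (i : ι) (c : ℂ) {k : ℕ} {n : ℤ} (hn : n.natAbs = k) :
    (-c) ^ k • β i n = -(c ^ k • β i n) := by
  by_cases h : Odd k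
  · rw [h.neg_pow, neg_smul]
  · rw [hβ.eq_zero i n (hn ▸ h), smul_zero, smul_zero, neg_zero]

theorem commute_expMinus (i j : ι) (c d : ℂˣ) (m n : ℤ) :
    Commute (intCoeff (expMinus (β i) c) m) (intCoeff (expMinus (β j) d) n) :=
  commute_intCoeff (commute_coeff_expSeries_expSeries (hβ.commute_coeff_logMinus i j c d)) m n

theorem commute_expPlus (i j : ι) (c d : ℂˣ) (m n : ℤ) :
    Commute (intCoeff (expPlus (β i) c) m) (intCoeff (expPlus (β j) d) n) :=
  commute_intCoeff (commute_coeff_expSeries_expSeries (hβ.commute_coeff_logPlus i j c d)) m n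

theorem commute_expPlus_expMinus {i j : ι} (hij : i ≠ j) (c d : ℂˣ) (m n : ℤ) :
    Commute (intCoeff (expPlus (β i) c) m) (intCoeff (expMinus (β j) d) n) := by
  refine commute_intCoeff (commute_coeff_expSeries_expSeries fun m n => ?_) m n
  rw [coeff_logPlus, coeff_logMinus]
  refine Commute.smul_left (Commute.smul_right ?_ _) _
  have := hβ.commutator i j m n
  rw [if_neg fun h => hij h.1, map_zero, sub_eq_zero] at this
  exact this

/-- The logarithmic derivatives have coefficients 2β(-k) and -2β(k), with commutator -4 · r/2 = -2r,
which is the hypothesis of `exchange_intCoeff`. -/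
theorem exchange (i : ι) (q p : ℤ) :
    intCoeff (expPlus (β i) 1) q * intCoeff (expMinus (β i) 1) p +
      intCoeff (expPlus (β i) 1) (q - 1) * intCoeff (expMinus (β i) 1) (p - 1) =
    intCoeff (expMinus (β i) 1) p * intCoeff (expPlus (β i) 1) q -
      intCoeff (expMinus (β i) 1) (p - 1) * intCoeff (expPlus (β i) 1) (q - 1) := by
  refine exchange_intCoeff (by simp [-PowerSeries.coeff_zero_eq_constantCoeff])
    (by simp [-PowerSeries.coeff_zero_eq_constantCoeff]) (coeff_zero_expSeries _)
    (hβ.eulerDer_expMinus i 1) (coeff_zero_expSeries _) (hβ.eulerDer_expPlus i 1)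
    (fun r s => ?_) q p
  rw [hβ.coeff_eulerDer_logMinus, hβ.coeff_eulerDer_logPlus, smul_mul_smul_comm,
    smul_mul_smul_comm, mul_comm (2 * _ : ℂ), ← smul_sub, hβ.commutator, Algebra.smul_def,
    ← map_mul]
  congr 1
  by_cases h : Odd r ∧ r = s
  · rw [if_pos ⟨rfl, h⟩, if_pos h]
    simp
    ring
  · rw [if_neg fun h' => h h'.2, if_neg h, mul_zero]

theorem eulerDer_logMinus_neg (i : ι) :
    eulerDer (logMinus (β i) (-1)) = -eulerDer (logMinus (β i) 1) := by
  ext1 k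
  rw [map_neg, hβ.coeff_eulerDer_logMinus, hβ.coeff_eulerDer_logMinus, mul_smul, mul_smul,
    Units.val_neg, hβ.neg_pow_smul i _ (by simp), smul_neg]

theorem eulerDer_logPlus_neg (i : ι) :
    eulerDer (logPlus (β i) (-1)) = -eulerDer (logPlus (β i) 1) := by
  ext1 k
  rw [map_neg, hβ.coeff_eulerDer_logPlus, hβ.coeff_eulerDer_logPlus, mul_smul, mul_smul,
    Units.val_neg, inv_neg, hβ.neg_pow_smul i _ (by simp), smul_neg]

theorem commute_eulerDer_logMinus (i : ι) (c d : ℂˣ) :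
    Commute (eulerDer (logMinus (β i) c)) (expMinus (β i) d) :=
  commute_eulerDer fun m n =>
    commute_coeff_expSeries (fun n => hβ.commute_coeff_logMinus i i c d m n) n

theorem commute_eulerDer_logPlus (i : ι) (c d : ℂˣ) :
    Commute (eulerDer (logPlus (β i) c)) (expPlus (β i) d) :=
  commute_eulerDer fun m n =>
    commute_coeff_expSeries (fun n => hβ.commute_coeff_logPlus i i c d m n) n

/-- The logarithms at z and -z cancel by oddness; here this appears as a vanishing Euler derivative
together with constant term 1. -/
theorem expMinus_mul_neg (i : ι) : expMinus (β i) 1 * expMinus (β i) (-1) = 1 := by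
  refine eq_of_eulerDer_eq (K := 0) (map_zero _) ?_ ?_ ?_
  · rw [PowerSeries.coeff_mul]
    simp only [Finset.HasAntidiagonal.antidiagonal_zero, Finset.sum_singleton, expMinus,
      coeff_zero_expSeries, PowerSeries.coeff_zero_one, mul_one]
  · rw [eulerDer_mul, hβ.eulerDer_expMinus, hβ.eulerDer_expMinus, hβ.eulerDer_logMinus_neg,
      neg_mul, mul_neg, (hβ.commute_eulerDer_logMinus i 1 1).eq, mul_assoc, zero_mul,
      add_neg_cancel]
  · rw [zero_mul, ← map_one PowerSeries.C, eulerDer_C]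

theorem expPlus_mul_neg (i : ι) : expPlus (β i) 1 * expPlus (β i) (-1) = 1 := by
  refine eq_of_eulerDer_eq (K := 0) (map_zero _) ?_ ?_ ?_
  · rw [PowerSeries.coeff_mul]
    simp only [Finset.HasAntidiagonal.antidiagonal_zero, Finset.sum_singleton, expPlus,
      coeff_zero_expSeries, PowerSeries.coeff_zero_one, mul_one]
  · rw [eulerDer_mul, hβ.eulerDer_expPlus, hβ.eulerDer_expPlus, hβ.eulerDer_logPlus_neg,
      neg_mul, mul_neg, (hβ.commute_eulerDer_logPlus i 1 1).eq, mul_assoc, zero_mul,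
      add_neg_cancel]
  · rw [zero_mul, ← map_one PowerSeries.C, eulerDer_C]

end IsHeisenberg

end Exponentials

/-! ### Normally ordered products -/

section NormalProd

variable {V : Type*} [AddCommGroup V] [Module ℂ V]

/-- On every vector, the products of coefficients of `B` and `B'` of large total degree vanish. -/
def JointlyFinite (B B' : PowerSeries (Module.End ℂ V)) : Prop :=
  ∀ v, ∃ K : ℕ, ∀ q q' : ℕ, K ≤ q + q' → PowerSeries.coeff q B (PowerSeries.coeff q' B' v) = 0

theorem JointlyFinite.locallyFinite_mul {B B' : PowerSeries (Module.End ℂ V)}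
    (h : JointlyFinite B B') : LocallyFinite (B * B') := by
  intro v
  obtain ⟨K, hK⟩ := h v
  refine ⟨K, fun q hq => ?_⟩
  rw [PowerSeries.coeff_mul, LinearMap.sum_apply]
  refine Finset.sum_eq_zero fun x hx => ?_
  rw [Finset.HasAntidiagonal.mem_antidiagonal] at hx
  exact hK _ _ (by omega)

theorem JointlyFinite.eulerDer_right {B B' : PowerSeries (Module.End ℂ V)}
    (h : JointlyFinite B B') : JointlyFinite B (eulerDer B') := by
  intro v
  obtain ⟨K, hK⟩ := h v
  refine ⟨K, fun q q' hq => ?_⟩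
  rw [coeff_eulerDer, ← nsmul_eq_mul, LinearMap.smul_apply, map_nsmul, hK q q' hq, smul_zero]

/-- The coefficient of `z^m w^n` in `A(z) A'(w) B(z) B'(w)`, for power series `A`, `A'` in `z`, `w`
and `B`, `B'` in `z⁻¹`, `w⁻¹`. -/
def normalProd (A A' B B' : PowerSeries (Module.End ℂ V)) (m n : ℤ) : Module.End ℂ V :=
  opSum fun x : ℤ × ℤ =>
    (intCoeff A (m + x.1) * intCoeff A' (n + x.2)) * (intCoeff B x.1 * intCoeff B' x.2)

theorem JointlyFinite.exists_box {B B' : PowerSeries (Module.End ℂ V)} (h : JointlyFinite B B')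
    (v : V) : ∃ K : ℤ, ∀ q q' : ℤ, ¬ (0 ≤ q ∧ q ≤ K ∧ 0 ≤ q' ∧ q' ≤ K) →
      (intCoeff B q * intCoeff B' q') v = 0 := by
  obtain ⟨K, hK⟩ := h v
  refine ⟨K, fun q q' hq => ?_⟩
  rcases lt_or_ge q 0 with h1 | h1
  · simp [intCoeff_of_neg B h1]
  rcases lt_or_ge q' 0 with h2 | h2
  · simp [intCoeff_of_neg B' h2]
  lift q to ℕ using h1
  lift q' to ℕ using h2
  rw [intCoeff_natCast, intCoeff_natCast]
  exact hK _ _ (by omega)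

theorem hasOpSum_normalProd {B B' : PowerSeries (Module.End ℂ V)} (h : JointlyFinite B B')
    (A A' : PowerSeries (Module.End ℂ V)) (m n : ℤ) :
    HasOpSum (fun x : ℤ × ℤ =>
      (intCoeff A (m + x.1) * intCoeff A' (n + x.2)) * (intCoeff B x.1 * intCoeff B' x.2))
      (normalProd A A' B B' m n) := by
  refine hasOpSum_opSum fun v => ?_
  obtain ⟨K, hK⟩ := h.exists_box v
  refine ((Set.finite_Icc (0 : ℤ) K).prod (Set.finite_Icc (0 : ℤ) K)).subset ?_
  rintro ⟨q, q'⟩ hx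
  simp only [Set.mem_prod, Set.mem_Icc]
  by_contra hne
  exact hx (by
    simp only [Module.End.mul_apply _ (intCoeff B q * intCoeff B' q')]
    rw [hK q q' (by tauto), map_zero])

/-- Specializing a normally ordered product to a single variable. -/
theorem hasOpSum_normalProd_diag {B B' : PowerSeries (Module.End ℂ V)} (h : JointlyFinite B B')
    (A A' : PowerSeries (Module.End ℂ V)) (hB : LocallyFinite (B * B')) (p : ℤ) :
    HasOpSum (fun n => normalProd A A' B B' (p - n) n) (mixedCoeff (A * A') (B * B') hB p) := by
  -- The triple family is summed in two orders: over (q, q') it gives the normally ordered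
  -- coefficients; over n it gives A A', and then over q + q' = s it gives B B'.
  set F : ℤ × (ℤ × ℤ) → Module.End ℂ V := fun y =>
    (intCoeff A (p - y.1 + y.2.1) * intCoeff A' (y.1 + y.2.2)) *
      (intCoeff B y.2.1 * intCoeff B' y.2.2) with hF
  have hfin : ∀ v, (Function.support fun y => F y v).Finite := by
    intro v
    obtain ⟨K, hK⟩ := h.exists_box v
    refine ((Set.finite_Icc (-K) (p + K)).prod
      ((Set.finite_Icc (0 : ℤ) K).prod (Set.finite_Icc (0 : ℤ) K))).subset ?_
    rintro ⟨n, q, q'⟩ hx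
    simp only [Set.mem_prod, Set.mem_Icc]
    by_cases h1 : 0 ≤ q ∧ q ≤ K ∧ 0 ≤ q' ∧ q' ≤ K
    · refine ⟨?_, by tauto⟩
      by_contra hne
      refine hx ?_
      rcases lt_or_ge n (-K) with h2 | h2
      · simp [hF, intCoeff_of_neg A' (show n + q' < 0 by omega)]
      · simp [hF, intCoeff_of_neg A (show p - n + q < 0 by omega)]
    · refine absurd ?_ hx
      simp only [hF, Module.End.mul_apply _ (intCoeff B q * intCoeff B' q')]
      rw [hK q q' h1, map_zero]
  obtain ⟨T, hT⟩ := HasOpSum.exists_of_finite hfin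
  have h1 : HasOpSum (fun n => normalProd A A' B B' (p - n) n) T :=
    hT.prod_fiberwise fun n => hasOpSum_normalProd h A A' (p - n) n
  have h2 : HasOpSum (fun x : ℤ × ℤ =>
      intCoeff (A * A') (p + x.1 + x.2) * (intCoeff B x.1 * intCoeff B' x.2)) T := by
    refine (hT.of_equiv (Equiv.prodComm (ℤ × ℤ) ℤ)).prod_fiberwise fun x => ?_
    refine (((hasOpSum_intCoeff_mul A A' (p + x.1 + x.2)).of_equiv
      (Equiv.addRight x.2)).mul_right (intCoeff B x.1 * intCoeff B' x.2)).congr fun n => ?_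
    simp only [hF, Equiv.prodComm_apply, Prod.swap]
    rw [Equiv.coe_addRight, show p + x.1 + x.2 - (n + x.2) = p - n + x.1 by ring]
  have h3 : HasOpSum (fun s => intCoeff (A * A') (p + s) * intCoeff (B * B') s) T := by
    let e : ℤ × ℤ ≃ ℤ × ℤ :=
      { toFun := fun x => (x.1 - x.2, x.2)
        invFun := fun x => (x.1 + x.2, x.2)
        left_inv := fun x => by simp
        right_inv := fun x => by simp }
    refine (h2.of_equiv e).prod_fiberwise fun s => ?_
    refine ((hasOpSum_intCoeff_mul B B' s).mul_left (intCoeff (A * A') (p + s))).congr fun n => ?_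
    simp only [e, Equiv.coe_fn_mk]
    rw [show p + (s - n) + n = p + s by ring]
  rw [(hasOpSum_mixedCoeff (A * A') (B * B') hB p).unique h3]
  exact h1

theorem normalProd_swap {A A' B B' : PowerSeries (Module.End ℂ V)} (h : JointlyFinite B B')
    (h' : JointlyFinite B' B) (hA : ∀ m n, Commute (intCoeff A m) (intCoeff A' n))
    (hB : ∀ m n, Commute (intCoeff B m) (intCoeff B' n)) (m n : ℤ) :
    normalProd A A' B B' m n = normalProd A' A B' B n m := by
  refine (hasOpSum_normalProd h A A' m n).unique
    (((hasOpSum_normalProd h' A' A n m).of_equiv (Equiv.prodComm ℤ ℤ)).congr fun x => ?_)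
  simp only [Equiv.prodComm_apply, Prod.fst_swap, Prod.snd_swap]
  rw [(hA _ _).eq, (hB _ _).eq]

theorem mixedCoeff_one_right (A : PowerSeries (Module.End ℂ V))
    (hB : LocallyFinite (1 : PowerSeries (Module.End ℂ V))) (p : ℤ) :
    mixedCoeff A 1 hB p = intCoeff A p := by
  refine (hasOpSum_mixedCoeff A 1 hB p).unique ((HasOpSum.single 0 fun s hs => ?_).congr' ?_)
  · rw [intCoeff_one, if_neg hs, mul_zero]
  · rw [intCoeff_one, if_pos rfl, mul_one, add_zero]

theorem mixedCoeff_one_left (B : PowerSeries (Module.End ℂ V)) (hB : LocallyFinite B) (p : ℤ) :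
    mixedCoeff 1 B hB p = intCoeff B (-p) := by
  refine (hasOpSum_mixedCoeff 1 B hB p).unique ((HasOpSum.single (-p) fun s hs => ?_).congr' ?_)
  · rw [intCoeff_one, if_neg (by omega), zero_mul]
  · rw [intCoeff_one, if_pos (by omega), one_mul]

theorem mixedCoeff_congr {A A' B B' : PowerSeries (Module.End ℂ V)} (hA : A = A') (hB : B = B')
    (h : LocallyFinite B) (h' : LocallyFinite B') (p : ℤ) :
    mixedCoeff A B h p = mixedCoeff A' B' h' p := by
  subst hA hB
  rfl

theorem intCoeff_eulerDer (f : PowerSeries (Module.End ℂ V)) (n : ℤ) :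
    intCoeff (eulerDer f) n = (n : ℂ) • intCoeff f n := by
  rcases lt_or_ge n 0 with h | h
  · simp [intCoeff_of_neg _ h]
  · lift n to ℕ using h
    rw [intCoeff_natCast, intCoeff_natCast, coeff_eulerDer, ← nsmul_eq_mul,
      ← Nat.cast_smul_eq_nsmul ℂ, Int.cast_natCast]

/-- The Euler derivation in the second variable of a normally ordered product. -/
theorem smul_normalProd {A A' B B' : PowerSeries (Module.End ℂ V)} (h : JointlyFinite B B')
    (m n : ℤ) : (n : ℂ) • normalProd A A' B B' m n =
      normalProd A (eulerDer A') B B' m n - normalProd A A' B (eulerDer B') m n := by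
  refine ((hasOpSum_normalProd h A A' m n).smul (n : ℂ)).unique
    (((hasOpSum_normalProd h A (eulerDer A') m n).sub
      (hasOpSum_normalProd h.eulerDer_right A A' m n)).congr fun x => ?_)
  -- The weight splits as n = (n + x.2) - x.2; the minus sign is there because `B'` is a series in
  -- w⁻¹.
  rw [intCoeff_eulerDer, intCoeff_eulerDer, mul_smul_comm, smul_mul_assoc, mul_smul_comm,
    mul_smul_comm, ← sub_smul]
  congr 1
  push_cast
  ring

theorem jointlyFinite_expPlus {B : PowerSeries (Module.End ℂ V)} {β : ℤ → Module.End ℂ V}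
    (h : JointlyFinite B (expPlus β 1)) (c : ℂˣ) : JointlyFinite B (expPlus β c) := by
  intro v
  obtain ⟨K, hK⟩ := h v
  refine ⟨K, fun q q' hq => ?_⟩
  rw [← intCoeff_natCast (expPlus β c), intCoeff_expPlus, intCoeff_natCast, LinearMap.smul_apply,
    map_smul, hK q q' hq, smul_zero]

theorem normalProd_expPlus_scale {A B : PowerSeries (Module.End ℂ V)} {β : ℤ → Module.End ℂ V}
    (h : JointlyFinite B (expPlus β 1)) (c : ℂˣ) (m n : ℤ) :
    normalProd A (expMinus β c) B (expPlus β c) m n =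
      (c : ℂ) ^ n • normalProd A (expMinus β 1) B (expPlus β 1) m n := by
  refine (hasOpSum_normalProd (jointlyFinite_expPlus h c) A (expMinus β c) m n).unique
    (((hasOpSum_normalProd h A (expMinus β 1) m n).smul ((c : ℂ) ^ n)).congr fun x => ?_)
  rw [intCoeff_expPlus β c, intCoeff_expMinus β c, mul_smul_comm, smul_mul_assoc, mul_smul_comm,
    mul_smul_comm, smul_smul, ← zpow_add₀ c.ne_zero]
  congr 2
  ring

end NormalProd

/-! ### Fermions -/

section Fermions

variable {ι V : Type*} [DecidableEq ι] [AddCommGroup V] [Module ℂ V]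
  {β : ι → ℤ → Module.End ℂ V}

/-- The coefficient of `z^m` in the product of the exponentials of `β_i`. -/
def vertexMode (β : ℤ → Module.End ℂ V) (hB : LocallyFinite (expPlus β 1)) (m : ℤ) :
    Module.End ℂ V :=
  mixedCoeff (expMinus β 1) (expPlus β 1) hB m

/-- The normally ordered product of two vertex operators. -/
def normalMode (β β' : ℤ → Module.End ℂ V) (m n : ℤ) : Module.End ℂ V :=
  normalProd (expMinus β 1) (expMinus β' 1) (expPlus β 1) (expPlus β' 1) m n

/-- The substitution w = cz in N(z, w). -/
theorem hasOpSum_normalMode_diag {β β' : ℤ → Module.End ℂ V} {c : ℂˣ}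
    (h : JointlyFinite (expPlus β 1) (expPlus β' 1))
    (hB : LocallyFinite (expPlus β 1 * expPlus β' c)) (p : ℤ) :
    HasOpSum (fun n => (c : ℂ) ^ n • normalMode β β' (p - n) n)
      (mixedCoeff (expMinus β 1 * expMinus β' c) (expPlus β 1 * expPlus β' c) hB p) :=
  (hasOpSum_normalProd_diag (jointlyFinite_expPlus h c) (expMinus β 1) (expMinus β' c) hB p).congr
    fun n => (normalProd_expPlus_scale h c (p - n) n).symm

/-- Very negative powers of z require an annihilation coefficient of large degree, since creation
coefficients have nonnegative index. -/
theorem exists_vertexMode_eq_zero {β : ℤ → Module.End ℂ V} (hB : LocallyFinite (expPlus β 1))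
    (v : V) : ∃ L : ℤ, ∀ n ≤ -L, vertexMode β hB n v = 0 := by
  obtain ⟨K, hK⟩ := hB v
  refine ⟨K, fun n hn => ((hasOpSum_mixedCoeff _ _ hB n) v).2.symm.trans ?_⟩
  refine finsum_eq_zero_of_forall_eq_zero fun s => ?_
  rcases lt_or_ge s 0 with h | h
  · simp [intCoeff_of_neg _ h]
  lift s to ℕ using h
  rcases lt_or_ge s K with h | h
  · simp [intCoeff_of_neg (expMinus β 1) (show n + s < 0 by omega)]
  · simp [intCoeff_natCast, hK s h]

namespace IsHeisenberg

variable (hβ : IsHeisenberg β)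
include hβ

section

variable {i j : ι} (hij : JointlyFinite (expPlus (β i) 1) (expPlus (β j) 1))
include hij

theorem normalMode_swap (hji : JointlyFinite (expPlus (β j) 1) (expPlus (β i) 1)) (m n : ℤ) :
    normalMode (β i) (β j) m n = normalMode (β j) (β i) n m :=
  normalProd_swap hij hji (hβ.commute_expMinus i j 1 1) (hβ.commute_expPlus i j 1 1) m n

/-- For distinct indices the inner annihilation and creation parts commute, so reordering produces
no contraction. -/
theorem vertexMode_mul_of_ne (hne : i ≠ j) (hi : LocallyFinite (expPlus (β i) 1))
    (hj : LocallyFinite (expPlus (β j) 1)) (m n : ℤ) :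
    vertexMode (β i) hi m * vertexMode (β j) hj n = normalMode (β i) (β j) m n := by
  refine HasOpSum.unique ((hasOpSum_mixedCoeff _ _ hi m).mul (hasOpSum_mixedCoeff _ _ hj n))
    ((hasOpSum_normalProd hij _ _ m n).congr fun x => ?_)
  rw [mul_assoc, mul_assoc, ← mul_assoc (intCoeff (expPlus (β i) 1) x.1),
    (hβ.commute_expPlus_expMinus hne 1 1 x.1 (n + x.2)).eq, mul_assoc]

end

variable {i : ι} (hii : JointlyFinite (expPlus (β i) 1) (expPlus (β i) 1))
  (hi : LocallyFinite (expPlus (β i) 1))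
include hii

/-- The coefficient of z^m w^n in (1 + w/z) ψ(z)ψ(w) = (1 - w/z) N(z, w), where ψ denotes the
bosonic part. -/
theorem vertexMode_mul_self_add (m n : ℤ) :
    vertexMode (β i) hi m * vertexMode (β i) hi n +
      vertexMode (β i) hi (m + 1) * vertexMode (β i) hi (n - 1) =
    normalMode (β i) (β i) m n - normalMode (β i) (β i) (m + 1) (n - 1) := by
  have hR : ∀ m n, HasOpSum (fun x : ℤ × ℤ => intCoeff (expMinus (β i) 1) (m + x.1) *
      (intCoeff (expPlus (β i) 1) x.1 * intCoeff (expMinus (β i) 1) (n + x.2)) *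
        intCoeff (expPlus (β i) 1) x.2) (vertexMode (β i) hi m * vertexMode (β i) hi n) :=
    fun m n => ((hasOpSum_mixedCoeff _ _ hi m).mul (hasOpSum_mixedCoeff _ _ hi n)).congr fun x => by
      simp only [mul_assoc]
  have hN := hasOpSum_normalProd hii (expMinus (β i) 1) (expMinus (β i) 1)
  -- Shifting `q` by one gives both products the same outer factors, so that `exchange` applies to
  -- the inner ones.
  let e : ℤ × ℤ ≃ ℤ × ℤ := (Equiv.subRight (1 : ℤ)).prodCongr (Equiv.refl ℤ)
  refine HasOpSum.unique ((hR m n).add ((hR (m + 1) (n - 1)).of_equiv e))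
    (((hN m n).sub ((hN (m + 1) (n - 1)).of_equiv e)).congr fun x => ?_)
  obtain ⟨q, q'⟩ := x
  have hx := hβ.exchange i q (n + q')
  simp only [e, Equiv.prodCongr_apply, Prod.map_apply, Equiv.subRight_apply, Equiv.refl_apply]
  rw [show m + 1 + (q - 1) = m + q by ring, show n - 1 + q' = n + q' - 1 by ring, ← add_mul,
    ← mul_add, hx]
  noncomm_ring

/-- The normally ordered product at `w = -z` is the identity. -/
theorem hasOpSum_normalMode_neg (p : ℤ) :
    HasOpSum (fun n => (-1 : ℂ) ^ n • normalMode (β i) (β i) (p - n) n)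
      (if p = 0 then 1 else 0) := by
  have h := hasOpSum_normalMode_diag (c := -1) hii (jointlyFinite_expPlus hii (-1)).locallyFinite_mul p
  rw [Units.val_neg, Units.val_one] at h
  refine h.congr' ?_
  have h1 : LocallyFinite (1 : PowerSeries (Module.End ℂ V)) := by
    rw [← hβ.expPlus_mul_neg i]
    exact (jointlyFinite_expPlus hii (-1)).locallyFinite_mul
  rw [mixedCoeff_congr (hβ.expMinus_mul_neg i) (hβ.expPlus_mul_neg i) _ h1, mixedCoeff_one_right,
    intCoeff_one]

/-- The derivative of the normally ordered product at `w = -z`. -/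
theorem hasOpSum_mul_normalMode_neg (p : ℤ) :
    HasOpSum (fun n : ℤ => ((n : ℂ) * (-1 : ℂ) ^ n) • normalMode (β i) (β i) (p - n) n)
      ((-2 : ℂ) • β i (-p)) := by
  have hJ := jointlyFinite_expPlus hii (-1)
  -- The exponential at -z is the inverse of the one at z, so the product is minus a logarithmic
  -- derivative.
  have hM : expMinus (β i) 1 * eulerDer (expMinus (β i) (-1)) = -eulerDer (logMinus (β i) 1) := by
    rw [hβ.eulerDer_expMinus, hβ.eulerDer_logMinus_neg, neg_mul, mul_neg, ← mul_assoc,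
      ← (hβ.commute_eulerDer_logMinus i 1 1).eq, mul_assoc, hβ.expMinus_mul_neg, mul_one]
  have hP : expPlus (β i) 1 * eulerDer (expPlus (β i) (-1)) = -eulerDer (logPlus (β i) 1) := by
    rw [hβ.eulerDer_expPlus, hβ.eulerDer_logPlus_neg, neg_mul, mul_neg, ← mul_assoc,
      ← (hβ.commute_eulerDer_logPlus i 1 1).eq, mul_assoc, hβ.expPlus_mul_neg, mul_one]
  have h1 : LocallyFinite (1 : PowerSeries (Module.End ℂ V)) := by
    rw [← hβ.expPlus_mul_neg i]
    exact hJ.locallyFinite_mul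
  have h2 : LocallyFinite (-eulerDer (logPlus (β i) 1)) := by
    rw [← hP]
    exact hJ.eulerDer_right.locallyFinite_mul
  have e1 := hasOpSum_normalProd_diag hJ (expMinus (β i) 1) (eulerDer (expMinus (β i) (-1)))
    hJ.locallyFinite_mul p
  have e2 := hasOpSum_normalProd_diag hJ.eulerDer_right (expMinus (β i) 1) (expMinus (β i) (-1))
    hJ.eulerDer_right.locallyFinite_mul p
  rw [mixedCoeff_congr hM (hβ.expPlus_mul_neg i) _ h1, mixedCoeff_one_right] at e1
  rw [mixedCoeff_congr (hβ.expMinus_mul_neg i) hP _ h2, mixedCoeff_one_left] at e2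
  refine ((e1.sub e2).congr fun n => ?_).congr' ?_
  · rw [← smul_normalProd hJ, normalProd_expPlus_scale hii, smul_smul, normalMode, Units.val_neg,
      Units.val_one]
  · have hc : ∀ (f : PowerSeries (Module.End ℂ V)) (k : ℕ), intCoeff (-f) k =
        -PowerSeries.coeff k f := fun f k => by rw [intCoeff_natCast, map_neg]
    -- Positive `p` sees only creation modes and negative `p` only annihilation modes; at `p = 0`
    -- both vanish because β(0) = 0.
    obtain ⟨k, rfl | rfl⟩ := p.eq_nat_or_neg
    · rw [hc, hβ.coeff_eulerDer_logMinus]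
      rcases Nat.eq_zero_or_pos k with rfl | hk
      · rw [Nat.cast_zero, neg_zero, ← Nat.cast_zero (R := ℤ), hc, hβ.coeff_eulerDer_logPlus]
        simp [hβ.apply_zero]
      · rw [intCoeff_of_neg _ (by omega)]
        simp
    · rw [neg_neg, hc, hβ.coeff_eulerDer_logPlus]
      rcases Nat.eq_zero_or_pos k with rfl | hk
      · rw [Nat.cast_zero, neg_zero, ← Nat.cast_zero (R := ℤ), hc, hβ.coeff_eulerDer_logMinus]
        simp [hβ.apply_zero]
      · rw [intCoeff_of_neg _ (by omega)]
        simp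

end IsHeisenberg

end Fermions

/-! ### Anticommutators and fermionic bilinears -/

/-- The vacuum expectation value of the product of the modes `m` and `n` of a fermion. -/
def vacuumValue (m n : ℤ) : ℂ :=
  if m + n = 0 then if 0 < n then 2 * (-1) ^ n else if n = 0 then 1 else 0 else 0

/-- The vacuum expectation of N is 1, so this is the scalar shadow of `vertexMode_mul_self_add`: (1
+ x) times (1 - x)/(1 + x) is 1 - x. -/
theorem vacuumValue_add_vacuumValue_shift (p n : ℤ) :
    vacuumValue (p - n) n + vacuumValue (p - (n - 1)) (n - 1) =
      (if p = 0 ∧ n = 0 then 1 else 0) - if p = 0 ∧ n = 1 then 1 else 0 := by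
  simp only [vacuumValue, sub_add_cancel]
  by_cases hp : p = 0
  · simp only [hp, if_true, true_and]
    rcases lt_trichotomy n 0 with h | rfl | h
    · simp [show ¬ 0 < n by omega, show n ≠ 0 by omega, show ¬ 1 < n by omega,
        show n ≠ 1 by omega, show n - 1 ≠ 0 by omega]
    · simp
    · by_cases h1 : n = 1
      · subst h1; norm_num
      · simp [h, h.ne', h1, show 1 < n by omega, zpow_sub_one₀]
  · simp [hp]

theorem vacuumValue_add_vacuumValue_swap (m n : ℤ) :
    vacuumValue m n + vacuumValue n m = if m + n = 0 then 2 * (-1) ^ n else 0 := by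
  by_cases h : m + n = 0
  · obtain rfl : m = -n := by omega
    simp only [vacuumValue, neg_add_cancel, add_neg_cancel, if_true]
    rcases lt_trichotomy n 0 with h | rfl | h
    · rw [if_neg (by omega), if_neg (by omega), if_pos (by omega), zero_add, zpow_neg, ← inv_zpow]
      norm_num
    · norm_num
    · rw [if_pos h, if_neg (by omega), if_neg (by omega), add_zero]
  · rw [vacuumValue, vacuumValue, if_neg h, if_neg (by omega), if_neg h, add_zero]

theorem hasOpSum_normalMode_sub {V : Type*} [AddCommGroup V] [Module ℂ V]
    {β : ℤ → Module.End ℂ V} {c : ℂˣ}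
    (hii : JointlyFinite (expPlus β 1) (expPlus β 1))
    (hB : LocallyFinite (expPlus β 1 * expPlus β c)) (p : ℤ) :
    HasOpSum (fun n => (c : ℂ) ^ n • (normalMode β β (p - n) n -
      (if p = 0 ∧ n = 0 then (1 : ℂ) else 0) • 1))
      (mixedCoeff (expMinus β 1 * expMinus β c) (expPlus β 1 * expPlus β c) hB p -
        if p = 0 then 1 else 0) := by
  have h : HasOpSum (fun n : ℤ => (c : ℂ) ^ n •
      ((if p = 0 ∧ n = 0 then (1 : ℂ) else 0) • (1 : Module.End ℂ V))) (if p = 0 then 1 else 0) := by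
    refine (HasOpSum.single 0 fun n hn => ?_).congr' ?_
    · rw [if_neg fun h => hn h.2, zero_smul, smul_zero]
    · split_ifs with h1 h2 h2
      · simp
      · exact absurd h1.1 h2
      · exact absurd ⟨h2, rfl⟩ h1
      · simp
  exact ((hasOpSum_normalMode_diag hii hB p).sub h).congr fun n => smul_sub _ _ _

/-! ### Anticommutation relations and the diagonal bilinear field -/

section Fermions

variable {ι V : Type*} [DecidableEq ι] [AddCommGroup V] [Module ℂ V]
  {β : ι → ℤ → Module.End ℂ V}

namespace IsHeisenberg

variable (hβ : IsHeisenberg β) {i : ι}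
  (hii : JointlyFinite (expPlus (β i) 1) (expPlus (β i) 1))
  (hi : LocallyFinite (expPlus (β i) 1))
include hβ hii

/-- By the recursion and the symmetry of N, the signed anticommutator `σ` is independent of `n`. It
is also the eventual value of (-1)^n r(n), which vanishes near -∞; summing increments gives 2 ∑
(-1)^n N(n), and N(z, -z) = 1 evaluates it. -/
theorem vertexMode_anticomm_apply (p n : ℤ) (v : V) :
    vertexMode (β i) hi (p - n) (vertexMode (β i) hi n v) +
      vertexMode (β i) hi n (vertexMode (β i) hi (p - n) v) =
    (if p = 0 then 2 * (-1 : ℂ) ^ n else 0) • v := by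
  set r : ℤ → V := fun n => vertexMode (β i) hi (p - n) (vertexMode (β i) hi n v) with hr
  set N : ℤ → V := fun n => normalMode (β i) (β i) (p - n) n v with hN
  have hr' : ∀ n, r (p - n) = vertexMode (β i) hi n (vertexMode (β i) hi (p - n) v) := fun n => by
    simp only [hr, sub_sub_cancel]
  have hsym : ∀ n, N (p - n) = N n := fun n => by
    simp only [hN, sub_sub_cancel]
    rw [hβ.normalMode_swap hii hii]
  have hrec : ∀ n, r n + r (n - 1) = N n - N (n - 1) := fun n => by
    have := LinearMap.congr_fun (hβ.vertexMode_mul_self_add hii hi (p - n) n) v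
    simpa only [hr, hN, LinearMap.add_apply, LinearMap.sub_apply, Module.End.mul_apply, show p - n + 1 = p - (n - 1) by ring] using this
  set σ : ℤ → V := fun n => (-1 : ℂ) ^ n • (r n + r (p - n)) with hσ
  have hstep : ∀ n, σ n = σ (n - 1) := fun n => by
    have h1 := hrec (p - (n - 1))
    rw [show p - (n - 1) - 1 = p - n by ring, hsym, hsym] at h1
    have h2 : r n + r (p - n) = -(r (n - 1) + r (p - (n - 1))) := by
      rw [eq_neg_iff_add_eq_zero, add_add_add_comm, hrec, add_comm (r (p - n)), h1]
      abel
    simp only [hσ]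
    rw [h2, zpow_sub_one₀ (by norm_num), inv_neg, inv_one, mul_neg_one, smul_neg, neg_smul]
  have hconst : ∀ n, σ n = σ 0 := fun n => by
    induction n using Int.induction_on with
    | zero => rfl
    | succ k ih => rw [hstep, add_sub_cancel_right, ih]
    | pred k ih => rw [← hstep, ih]
  obtain ⟨L, hL⟩ := exists_vertexMode_eq_zero hi v
  have htel : HasFinsum (fun n => (-1 : ℂ) ^ n • r n - (-1 : ℂ) ^ (n - 1) • r (n - 1)) (σ 0) := by
    -- Below `-L` the inner mode kills `v`; above `p + L` one has p - n ≤ -L, so r(p - n) vanishes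
    -- and (-1)^n r(n) is σ(n).
    refine HasFinsum.telescope (ρ := fun n => (-1 : ℂ) ^ n • r n) (max L (p + L))
      (fun n hn => ?_) fun n hn => ?_
    · simp only [hr]
      rw [hL n (by have := le_max_left L (p + L); omega), map_zero, smul_zero]
    · rw [← hconst n]
      simp only [hσ]
      rw [hr', hL (p - n) (by have := le_max_right L (p + L); omega), map_zero, add_zero]
  have hNsum : HasFinsum (fun n => (-1 : ℂ) ^ n • N n) ((if p = 0 then (1 : ℂ) else 0) • v) := by
    have := hβ.hasOpSum_normalMode_neg hii p v
    simp only [LinearMap.smul_apply] at this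
    convert this using 1
    split_ifs <;> simp
  have h2 := hNsum.add (hNsum.of_equiv (Equiv.subRight (1 : ℤ)))
  have h3 : σ 0 = (if p = 0 then (1 : ℂ) else 0) • v + (if p = 0 then (1 : ℂ) else 0) • v := by
    refine htel.unique ?_
    convert h2 using 2 with n
    have e : (-1 : ℂ) ^ (n - 1) = -(-1 : ℂ) ^ n := by
      rw [zpow_sub_one₀ (by norm_num)]; norm_num
    rw [Equiv.subRight_apply, e, neg_smul, neg_smul, sub_neg_eq_add, ← smul_add, hrec, smul_sub,
      sub_eq_add_neg]
  have h4 := hconst n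
  rw [h3] at h4
  have h5 : (-1 : ℂ) ^ n * (-1 : ℂ) ^ n = 1 := by rw [← mul_zpow]; norm_num
  have h6 : r n + r (p - n) = (-1 : ℂ) ^ n • σ n := by
    simp only [hσ]
    rw [smul_smul, h5, one_smul]
  rw [← hr']
  refine h6.trans ?_
  rw [h4, ← add_smul, smul_smul]
  congr 1
  split_ifs <;> ring

/-- The canonical anticommutation relations. -/
theorem vertexMode_anticomm (m n : ℤ) :
    vertexMode (β i) hi m * vertexMode (β i) hi n + vertexMode (β i) hi n * vertexMode (β i) hi m =
      (if m + n = 0 then 2 * (-1 : ℂ) ^ n else 0) • 1 :=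
  LinearMap.ext fun v => by
    have := hβ.vertexMode_anticomm_apply hii hi (m + n) n v
    rwa [add_sub_cancel_right] at this

/-- For very negative `n` the right factor kills `v` and the vacuum value is zero. For large `n` the
anticommutator equals the vacuum value and the swapped product kills `v`. This is why the vacuum
value must be subtracted. -/
theorem exists_hasOpSum_bilinear (w : ℤ → ℂ) (p : ℤ) :
    ∃ T, HasOpSum (fun n => w n • (vertexMode (β i) hi (p - n) * vertexMode (β i) hi n -
      vacuumValue (p - n) n • 1)) T := by
  refine HasOpSum.exists_of_finite fun v => ?_
  obtain ⟨L, hL⟩ := exists_vertexMode_eq_zero hi v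
  refine (Set.finite_Icc (-|L|) (|p| + |L|)).subset fun n hn => ?_
  have := le_abs_self L
  have := abs_nonneg L
  have := le_abs_self p
  have := abs_nonneg p
  by_contra hne
  rw [Set.mem_Icc, not_and_or, not_le, not_le] at hne
  refine hn ?_
  simp only [LinearMap.smul_apply, LinearMap.sub_apply, Module.End.mul_apply, Module.End.one_apply]
  rcases hne with h | h
  · rw [hL n (by omega), map_zero, vacuumValue, if_neg (show ¬ 0 < n by omega),
      if_neg (show n ≠ 0 by omega), ite_self, zero_smul, sub_zero, smul_zero]
  · rw [eq_sub_of_add_eq (hβ.vertexMode_anticomm_apply hii hi p n v), hL (p - n) (by omega),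
      map_zero, vacuumValue, if_pos (show 0 < n by omega), sub_add_cancel, sub_zero, sub_self,
      smul_zero]

theorem bilinear_add_bilinear_shift (p n : ℤ) :
    (vertexMode (β i) hi (p - n) * vertexMode (β i) hi n - vacuumValue (p - n) n • 1) +
      (vertexMode (β i) hi (p - (n - 1)) * vertexMode (β i) hi (n - 1) -
        vacuumValue (p - (n - 1)) (n - 1) • 1) =
    (normalMode (β i) (β i) (p - n) n - (if p = 0 ∧ n = 0 then (1 : ℂ) else 0) • 1) -
      (normalMode (β i) (β i) (p - (n - 1)) (n - 1) -
        (if p = 0 ∧ n - 1 = 0 then (1 : ℂ) else 0) • 1) := by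
  have h1 := hβ.vertexMode_mul_self_add hii hi (p - n) n
  rw [show p - n + 1 = p - (n - 1) by ring] at h1
  have h2 := congrArg (fun x : ℂ => x • (1 : Module.End ℂ V))
    (vacuumValue_add_vacuumValue_shift p n)
  simp only [add_smul, sub_smul] at h2
  simp only [sub_eq_zero (a := n)]
  rw [sub_add_sub_comm, h1, h2]
  abel

/-- The bilinear field of a fermion with itself in terms of vertex operators. -/
theorem hasOpSum_bilinear_self (a : ℂˣ)
    (hB : LocallyFinite (expPlus (β i) 1 * expPlus (β i) (-a))) (p : ℤ) :
    HasOpSum (fun n => (-(a : ℂ)) ^ n •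
      (vertexMode (β i) hi (p - n) * vertexMode (β i) hi n - vacuumValue (p - n) n • 1))
      (if a = 1 then (4 : ℂ) • β i (-p) else ((1 + (a : ℂ)) / (1 - (a : ℂ))) •
        (mixedCoeff (expMinus (β i) 1 * expMinus (β i) (-a))
          (expPlus (β i) 1 * expPlus (β i) (-a)) hB p - if p = 0 then 1 else 0)) := by
  have ha0 : (-(a : ℂ)) ≠ 0 := neg_ne_zero.mpr a.ne_zero
  obtain ⟨T, hT⟩ := hβ.exists_hasOpSum_bilinear hii hi (fun n => (-(a : ℂ)) ^ n) p
  refine hT.congr' ?_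
  have hM := hasOpSum_normalMode_sub hii hB p
  rw [Units.val_neg] at hM
  by_cases h1 : a = 1
  · rw [if_pos h1]
    subst h1
    rw [Units.val_one] at hT hM
    -- At a = 1 the factor 1 - a degenerates, so the recursion is summed with the extra weight `n`,
    -- in effect a derivative in a.
    obtain ⟨U, hU⟩ := hβ.exists_hasOpSum_bilinear hii hi (fun n => (n : ℂ) * (-1 : ℂ) ^ n) p
    have hW : HasOpSum (fun n : ℤ => ((n : ℂ) * (-1 : ℂ) ^ n) •
        (normalMode (β i) (β i) (p - n) n - (if p = 0 ∧ n = 0 then (1 : ℂ) else 0) • 1))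
        ((-2 : ℂ) • β i (-p)) := by
      refine (hβ.hasOpSum_mul_normalMode_neg hii p).congr fun n => ?_
      by_cases hn : n = 0
      · simp [hn]
      · rw [if_neg fun h => hn h.2, zero_smul, sub_zero]
    have hM0 : HasOpSum (fun n : ℤ => (-1 : ℂ) ^ n •
        (normalMode (β i) (β i) (p - n) n - (if p = 0 ∧ n = 0 then (1 : ℂ) else 0) • 1)) 0 := by
      refine hM.congr' ?_
      have := (hasOpSum_normalMode_diag (c := -1) hii hB p).congr' rfl
      rw [Units.val_neg, Units.val_one] at this
      rw [this.unique (hβ.hasOpSum_normalMode_neg hii p), sub_self]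
    have e : ∀ n : ℤ, (-1 : ℂ) ^ (n - 1) = -(-1 : ℂ) ^ n := fun n => by
      rw [zpow_sub_one₀ (by norm_num)]; norm_num
    have l1 := (hU.add hT).of_equiv (Equiv.subRight (1 : ℤ))
    have r1 := (hW.add hM0).of_equiv (Equiv.subRight (1 : ℤ))
    -- The weighted recursion sums to U - (U + T) = -T on the left and to twice -2β(-p) on the
    -- right.
    have key := (hU.sub l1).unique ((hW.add r1).congr fun n => ?_)
    · rw [add_zero, sub_add_cancel_left, ← add_smul] at key
      rw [← neg_neg T, key, ← neg_smul]
      norm_num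
    · simp only [Equiv.subRight_apply, ← add_smul, ← add_one_mul]
      rw [e, Int.cast_sub, Int.cast_one, sub_add_cancel, mul_neg, neg_smul, neg_smul,
        sub_neg_eq_add, ← smul_add, hβ.bilinear_add_bilinear_shift hii hi, smul_sub,
        sub_eq_add_neg]
  · rw [if_neg h1]
    have h1' : (1 - (a : ℂ)) ≠ 0 := fun h => h1 (Units.ext (by
      rw [Units.val_one]; exact (sub_eq_zero.mp h).symm))
    have l1 := (hT.of_equiv (Equiv.subRight (1 : ℤ))).smul (-(a : ℂ))
    have r1 := (hM.of_equiv (Equiv.subRight (1 : ℤ))).smul (-(a : ℂ))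
    have e : ∀ n : ℤ, (-(a : ℂ)) * (-(a : ℂ)) ^ (n - 1) = (-(a : ℂ)) ^ n := fun n => by
      rw [zpow_sub_one₀ ha0]; field_simp
    -- Summing the recursion with weights (-a)^n gives T - aT = M + aM, where M is the normally
    -- ordered sum minus its constant.
    have key := (hT.add l1).unique ((hM.sub r1).congr fun n => ?_)
    · have key' : (1 - (a : ℂ)) • T = (1 + (a : ℂ)) • (mixedCoeff
          (expMinus (β i) 1 * expMinus (β i) (-a))
          (expPlus (β i) 1 * expPlus (β i) (-a)) hB p - if p = 0 then 1 else 0) := by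
        rw [sub_smul, add_smul, one_smul, one_smul, sub_eq_add_neg, ← neg_smul, key, neg_smul,
          sub_neg_eq_add]
      rw [div_eq_inv_mul, mul_smul, ← key', smul_smul, inv_mul_cancel₀ h1', one_smul]
    · simp only [Equiv.subRight_apply, smul_smul, e]
      rw [← smul_add, hβ.bilinear_add_bilinear_shift hii hi, smul_sub]

end IsHeisenberg

end Fermions

/-! ### Commutators of fermionic bilinears -/

/-- The coefficients of the vacuum expectation value of a bilinear field. -/
def vacuumCoeff (u : ℂ) (s : ℤ) : ℂ := (-u) ^ s * vacuumValue (-s) s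

theorem vacuumCoeff_eq (u : ℂ) (s : ℤ) :
    vacuumCoeff u s = if 0 < s then 2 * u ^ s else if s = 0 then 1 else 0 := by
  rw [vacuumCoeff, vacuumValue, if_pos (neg_add_cancel s)]
  split_ifs with h1 h2
  · rw [mul_left_comm, ← mul_zpow, neg_mul_neg, mul_one]
  · simp [h2]
  · simp

/-- The value of `∑ (g(s) - u^(-p) g(s+p))` for `g = vacuumCoeff u`. -/
def vacuumDefect (u : ℂ) (p : ℤ) : ℂ :=
  if u = 1 then -2 * p else (1 - u ^ (-p)) * ((1 + u) / (1 - u))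

theorem vacuumDefect_add_one {u : ℂ} (hu : u ≠ 0) (p : ℤ) :
    vacuumDefect u (p + 1) = vacuumDefect u p + u ^ (-p) * (-u⁻¹ + -1) := by
  rw [vacuumDefect, vacuumDefect]
  split_ifs with h
  · subst h
    push_cast
    simp
    ring
  · have : (1 - u) ≠ 0 := fun h' => h (sub_eq_zero.mp h').symm
    rw [neg_add, zpow_add₀ hu, zpow_neg_one]
    field_simp
    ring

/-- Formally ∑ g(s) is (1 + u)/(1 - u) and the shift by `p` multiplies it by u^(-p); -2p is the
limit at u = 1. Rigorously, the tails cancel, a shift by one leaves only s = -1 and s = 0, and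
induction in both directions gives every `p`. -/
theorem hasFinsum_vacuumCoeff {u : ℂ} (hu : u ≠ 0) (p : ℤ) :
    HasFinsum (fun s => vacuumCoeff u s - u ^ (-p) * vacuumCoeff u (s + p)) (vacuumDefect u p) := by
  have h1 : HasFinsum (fun s => vacuumCoeff u s - u⁻¹ * vacuumCoeff u (s + 1)) (-u⁻¹ + -1) := by
    have e1 := HasFinsum.single (f := fun s : ℤ => if s = -1 then -u⁻¹ else 0) (-1)
      fun j hj => if_neg hj
    have e2 := HasFinsum.single (f := fun s : ℤ => if s = 0 then (-1 : ℂ) else 0) 0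
      fun j hj => if_neg hj
    have e := e1.add e2
    simp only [if_true] at e
    refine e.congr fun s => ?_
    rw [vacuumCoeff_eq, vacuumCoeff_eq]
    rcases lt_trichotomy s 0 with h | rfl | h
    · by_cases hs : s = -1
      · subst hs
        norm_num
      · simp [show ¬ 0 < s by omega, show s ≠ 0 by omega, show ¬ 0 < s + 1 by omega,
          show s + 1 ≠ 0 by omega, hs]
    · norm_num
      field_simp
      norm_num
    · rw [if_pos h, if_pos (by omega), if_neg (by omega), if_neg (by omega), zpow_add_one₀ hu]
      field_simp
      ring
  have h2 : ∀ p : ℤ, HasFinsum (fun s => u ^ (-p) * (vacuumCoeff u (s + p) -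
      u⁻¹ * vacuumCoeff u (s + p + 1))) (u ^ (-p) * (-u⁻¹ + -1)) := fun p =>
    (h1.of_equiv (Equiv.addRight p)).map (AddMonoidHom.mulLeft (u ^ (-p)))
  have e : ∀ p : ℤ, u ^ (-(p + 1)) = u ^ (-p) * u⁻¹ := fun p => by
    rw [neg_add, zpow_add₀ hu, zpow_neg_one]
  induction p using Int.induction_on with
  | zero =>
    have h0 : vacuumDefect u 0 = 0 := by simp [vacuumDefect]
    rw [h0]
    refine HasFinsum.zero.congr fun s => ?_
    simp
  | succ k ih =>
    rw [vacuumDefect_add_one hu]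
    refine (ih.add (h2 k)).congr fun s => ?_
    rw [e, ← add_assoc s]
    ring
  | pred k ih =>
    have hk := vacuumDefect_add_one hu (-(k : ℤ) - 1)
    rw [sub_add_cancel] at hk
    rw [← sub_eq_iff_eq_add.mpr hk]
    refine (ih.sub (h2 (-(k : ℤ) - 1))).congr fun s => ?_
    have := e (-(k : ℤ) - 1)
    rw [sub_add_cancel] at this
    rw [this, add_assoc s (-(k : ℤ) - 1) 1, sub_add_cancel]
    ring

/-- Collects the vacuum expectations of the four bilinears in the commutator. Each diverges
separately; they pair into two differences, with u = ab and u = a/b. -/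
theorem hasFinsum_commutator_scalar {ι : Type*} [DecidableEq ι] (i j k l : ι) (a b : ℂˣ) (p q : ℤ) :
    HasFinsum (fun s =>
      2 * kron j k * (a : ℂ) ^ (-q) * (-((a : ℂ) * b)) ^ s *
          (kron i l * vacuumValue (p + q - s) s) -
        2 * kron i l * (b : ℂ) ^ (-p) * (-((a : ℂ) * b)) ^ (p + s) *
          (kron k j * vacuumValue (q - s) (p + s)) -
        2 * kron i k * (-1) ^ q * (b : ℂ) ^ (p + q) * (-((a : ℂ) * (b : ℂ)⁻¹)) ^ (p + q - s) *
          (kron l j * vacuumValue (p + q - s) s) +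
        2 * kron j l * (-((b : ℂ) * (a : ℂ)⁻¹)) ^ q * (-((a : ℂ) * (b : ℂ)⁻¹)) ^ (q - s) *
          (kron i k * vacuumValue (q - s) (p + s)))
      (if p + q = 0 then
        2 * kron j k * kron i l * (a : ℂ) ^ p * vacuumDefect (a * b) p +
        2 * kron i k * kron j l * (-1) ^ p * vacuumDefect (a * (b : ℂ)⁻¹) (-p) else 0) := by
  have ha : (a : ℂ) ≠ 0 := a.ne_zero
  have hb : (b : ℂ) ≠ 0 := b.ne_zero
  have hcomm : ∀ x y : ι, kron x y = kron y x := fun x y => by simp only [kron, eq_comm]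
  by_cases ht : p + q = 0
  · obtain rfl : q = -p := by omega
    rw [if_pos ht]
    have h1 := (hasFinsum_vacuumCoeff (mul_ne_zero ha hb) p).map
      (AddMonoidHom.mulLeft (2 * kron j k * kron i l * (a : ℂ) ^ p))
    have h2 := ((hasFinsum_vacuumCoeff (mul_ne_zero ha (inv_ne_zero hb)) (-p)).of_equiv
      (Equiv.neg ℤ)).map (AddMonoidHom.mulLeft (2 * kron i k * kron j l * (-1) ^ p))
    refine (h1.add h2).congr fun s => ?_
    set u : ℂ := (a : ℂ) * (b : ℂ)⁻¹ with hu
    have hu0 : -u ≠ 0 := by simp [hu, ha, hb]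
    have hn : (-1 : ℂ) ≠ 0 := by norm_num
    have f1 : (a : ℂ) ^ p * ((a : ℂ) * b) ^ (-p) = (b : ℂ) ^ (-p) := by
      rw [mul_zpow, ← mul_assoc, ← zpow_add₀ ha, add_neg_cancel, zpow_zero, one_mul]
    have f2 : (-1 : ℂ) ^ (-p) = (-1) ^ p := by rw [zpow_neg, ← inv_zpow]; norm_num
    have f3 : (-((b : ℂ) * (a : ℂ)⁻¹)) ^ (-p) * (-u) ^ (-p - s) = (-u) ^ (-s) := by
      have : -((b : ℂ) * (a : ℂ)⁻¹) = (-u)⁻¹ := by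
        rw [hu, inv_neg, mul_inv, inv_inv, mul_comm]
      rw [this, inv_zpow', ← zpow_add₀ hu0]
      congr 1
      ring
    have f4 : (-1) ^ p * u ^ p * (-u) ^ (-s + -p) = (-u) ^ (-s) := by
      rw [← mul_zpow, neg_one_mul, ← zpow_add₀ hu0]
      congr 1
      ring
    have f5 := vacuumValue_add_vacuumValue_swap s (-s)
    have f6 := vacuumValue_add_vacuumValue_swap (p + s) (-p - s)
    rw [if_pos (by ring)] at f5 f6
    have f7 : (-1 : ℂ) ^ (-p - s) = (-1) ^ p * (-1) ^ (-s) := by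
      rw [sub_eq_add_neg, zpow_add₀ hn, f2]
    simp only [AddMonoidHom.coe_mulLeft, vacuumCoeff, Equiv.neg_apply, neg_neg]
    rw [show p + -p - s = -s by ring, show -(s + p) = -p - s by ring, add_comm s p,
      add_neg_cancel, zpow_zero, f2, hcomm k j, hcomm l j,
      show -(-s + -p) = p + s by ring, show (-s + -p : ℤ) = -p - s by ring] at *
    rw [f7] at f6
    -- The u = a/b pair arrives with its vacuum values in the opposite order; `f5` and `f6` reverse
    -- them, and the two anticommutator values so produced cancel.
    linear_combination (2 * kron j k * kron i l * (-((a : ℂ) * b)) ^ (p + s) *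
      vacuumValue (-p - s) (p + s)) * f1 + 2 * kron i k * kron j l *
      (vacuumValue (-p - s) (p + s) * f3 + vacuumValue (p + s) (-p - s) * f4 -
        (-1) ^ p * (-u) ^ (-s) * f5 + (-u) ^ (-s) * f6)
  · rw [if_neg ht]
    refine HasFinsum.zero.congr fun s => ?_
    have e1 : vacuumValue (p + q - s) s = 0 := if_neg (by omega)
    have e2 : vacuumValue (q - s) (p + s) = 0 := if_neg (by omega)
    rw [e1, e2]
    ring

/-! ### The commutator of two bilinear fields -/

section Bilinear

variable {ι V : Type*} [DecidableEq ι] [AddCommGroup V] [Module ℂ V]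

/-- A family of fermions `ψ` and of bilinear fields `X` in these fermions. -/
structure IsFermionBilinear (ψ : ι → ℤ → Module.End ℂ V) (X : ι → ι → ℂˣ → ℤ → Module.End ℂ V) :
    Prop where
  anticomm (i j : ι) (m n : ℤ) : ψ i m * ψ j n + ψ j n * ψ i m =
    (kron i j * (vacuumValue m n + vacuumValue n m)) • 1
  hasOpSum (i j : ι) (a : ℂˣ) (p : ℤ) :
    HasOpSum (fun n => (-(a : ℂ)) ^ n •
      (ψ i (p - n) * ψ j n - (kron i j * vacuumValue (p - n) n) • 1)) (X i j a p)

namespace IsFermionBilinear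

variable {ψ : ι → ℤ → Module.End ℂ V} {X : ι → ι → ℂˣ → ℤ → Module.End ℂ V}
  (h : IsFermionBilinear ψ X)
include h

/-- Uses [AB, C] = A{B, C} - {A, C}B; each anticommutator is a scalar supported at a single `n`, so
each sum has one term. -/
theorem commutator_fermion (i j k : ι) (a : ℂˣ) (p r : ℤ) :
    X i j a p * ψ k r - ψ k r * X i j a p =
      (2 * kron j k * (a : ℂ) ^ (-r)) • ψ i (p + r) -
        (2 * kron i k * (-1) ^ p * (a : ℂ) ^ (p + r)) • ψ j (p + r) := by
  have ha : (a : ℂ) ≠ 0 := a.ne_zero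
  have h1 := ((h.hasOpSum i j a p).mul_right (ψ k r)).sub ((h.hasOpSum i j a p).mul_left (ψ k r))
  have s1 : HasOpSum (fun n => ((-(a : ℂ)) ^ n * (kron j k *
      (vacuumValue n r + vacuumValue r n))) • ψ i (p - n))
      ((2 * kron j k * (a : ℂ) ^ (-r)) • ψ i (p + r)) := by
    refine (HasOpSum.single (-r) fun n hn => ?_).congr' ?_
    · rw [vacuumValue_add_vacuumValue_swap, if_neg (by omega), mul_zero, mul_zero, zero_smul]
    · rw [vacuumValue_add_vacuumValue_swap, if_pos (by omega), sub_neg_eq_add]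
      congr 1
      have : (-(a : ℂ)) ^ (-r) * (-1) ^ r = (a : ℂ) ^ (-r) := by
        rw [neg_eq_neg_one_mul, mul_zpow, mul_right_comm, ← zpow_add₀ (by norm_num)]
        simp
      linear_combination (2 * kron j k) * this
  have s2 : HasOpSum (fun n => ((-(a : ℂ)) ^ n * (kron i k *
      (vacuumValue (p - n) r + vacuumValue r (p - n)))) • ψ j n)
      ((2 * kron i k * (-1) ^ p * (a : ℂ) ^ (p + r)) • ψ j (p + r)) := by
    refine (HasOpSum.single (p + r) fun n hn => ?_).congr' ?_
    · rw [vacuumValue_add_vacuumValue_swap, if_neg (by omega), mul_zero, mul_zero, zero_smul]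
    · rw [vacuumValue_add_vacuumValue_swap, if_pos (by omega)]
      congr 1
      have : (-(a : ℂ)) ^ (p + r) * (-1) ^ r = (-1) ^ p * (a : ℂ) ^ (p + r) := by
        have e : ((-1 : ℂ) ^ r) * (-1 : ℂ) ^ r = 1 := by rw [← mul_zpow]; norm_num
        rw [neg_eq_neg_one_mul, mul_zpow, zpow_add₀ (show (-1 : ℂ) ≠ 0 by norm_num)]
        linear_combination ((-1) ^ p * (a : ℂ) ^ (p + r)) * e
      linear_combination (2 * kron i k) * this
  refine h1.unique ((s1.sub s2).congr fun n => ?_)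
  rw [smul_mul_assoc, mul_smul_comm, ← smul_sub, mul_smul ((-(a : ℂ)) ^ n),
    mul_smul ((-(a : ℂ)) ^ n), ← smul_sub]
  congr 1
  have e1 := h.anticomm j k n r
  have e2 := h.anticomm i k (p - n) r
  have e3 : (ψ i (p - n) * ψ j n - (kron i j * vacuumValue (p - n) n) • 1) * ψ k r -
      ψ k r * (ψ i (p - n) * ψ j n - (kron i j * vacuumValue (p - n) n) • 1) =
      ψ i (p - n) * (ψ j n * ψ k r + ψ k r * ψ j n) -
        (ψ i (p - n) * ψ k r + ψ k r * ψ i (p - n)) * ψ j n := by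
    rw [sub_mul, mul_sub, smul_mul_assoc, mul_smul_comm, one_mul, mul_one]
    noncomm_ring
  rw [e3, e1, e2, smul_mul_assoc, mul_smul_comm, one_mul, mul_one]

/-- The Leibniz rule in the second bilinear gives four products of two fermions. Two must be
reversed to match X_lj and X_ik, and the vacuum subtractions in the resulting fields are compensated
by the scalar of `hasFinsum_commutator_scalar`. -/
theorem commutator (i j k l : ι) (a b : ℂˣ) (p q : ℤ) :
    X i j a p * X k l b q - X k l b q * X i j a p =
      (2 * kron j k * (a : ℂ) ^ (-q)) • X i l (a * b) (p + q) -
      (2 * kron i l * (b : ℂ) ^ (-p)) • X k j (a * b) (p + q) +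
      (2 * kron i k * (-1) ^ q * (b : ℂ) ^ (p + q)) • X l j (a * b⁻¹) (p + q) -
      (2 * kron j l * (-((b : ℂ) * (a : ℂ)⁻¹)) ^ q) • X i k (a * b⁻¹) (p + q) +
      (if p + q = 0 then
        2 * kron j k * kron i l * (a : ℂ) ^ p * vacuumDefect (a * b) p +
        2 * kron i k * kron j l * (-1) ^ p * vacuumDefect (a * (b : ℂ)⁻¹) (-p) else 0) • 1 := by
  have ha : (a : ℂ) ≠ 0 := a.ne_zero
  have hb : (b : ℂ) ≠ 0 := b.ne_zero
  have h0 := ((h.hasOpSum k l b q).mul_left (X i j a p)).sub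
    ((h.hasOpSum k l b q).mul_right (X i j a p))
  have h1 := (h.hasOpSum i l (a * b) (p + q)).smul (2 * kron j k * (a : ℂ) ^ (-q))
  -- The reindexings in `h2`, `h3`, `h4` make all four fields involve the same modes at index `s`,
  -- so that the sums can be compared termwise.
  have h2 := ((h.hasOpSum k j (a * b) (p + q)).of_equiv (Equiv.addLeft p)).smul
    (2 * kron i l * (b : ℂ) ^ (-p))
  have h3 := ((h.hasOpSum l j (a * b⁻¹) (p + q)).of_equiv (Equiv.subLeft (p + q))).smul
    (2 * kron i k * (-1) ^ q * (b : ℂ) ^ (p + q))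
  have h4 := ((h.hasOpSum i k (a * b⁻¹) (p + q)).of_equiv (Equiv.subLeft q)).smul
    (2 * kron j l * (-((b : ℂ) * (a : ℂ)⁻¹)) ^ q)
  have h5 := HasOpSum.of_scalar (hasFinsum_commutator_scalar i j k l a b p q)
    (1 : Module.End ℂ V)
  refine h0.unique (((((h1.sub h2).add h3).sub h4).add h5).congr fun s => ?_)
  simp only [Equiv.coe_addLeft, Equiv.subLeft_apply, Units.val_mul, Units.val_inv_eq_inv_val]
  rw [show p + q - (p + s) = q - s by ring, show p + q - (p + q - s) = s by ring,
    show p + q - (q - s) = p + s by ring]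
  have e3 : ψ l s * ψ j (p + q - s) = (kron l j * (vacuumValue s (p + q - s) +
      vacuumValue (p + q - s) s)) • 1 - ψ j (p + q - s) * ψ l s :=
    eq_sub_of_add_eq (h.anticomm l j s (p + q - s))
  have e4 : ψ i (p + s) * ψ k (q - s) = (kron i k * (vacuumValue (p + s) (q - s) +
      vacuumValue (q - s) (p + s))) • 1 - ψ k (q - s) * ψ i (p + s) :=
    eq_sub_of_add_eq (h.anticomm i k (p + s) (q - s))
  have e5 : X i j a p * (ψ k (q - s) * ψ l s - (kron k l * vacuumValue (q - s) s) • 1) -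
      (ψ k (q - s) * ψ l s - (kron k l * vacuumValue (q - s) s) • 1) * X i j a p =
      (X i j a p * ψ k (q - s) - ψ k (q - s) * X i j a p) * ψ l s +
        ψ k (q - s) * (X i j a p * ψ l s - ψ l s * X i j a p) := by
    rw [sub_mul, mul_sub, smul_mul_assoc, mul_smul_comm, one_mul, mul_one]
    noncomm_ring
  have n1 : ∀ n : ℤ, ((-1 : ℂ) ^ n) * (-1 : ℂ) ^ n = 1 := fun n => by rw [← mul_zpow]; norm_num
  have c1 : (-(b : ℂ)) ^ s * (2 * kron j k * (a : ℂ) ^ (-(q - s))) =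
      2 * kron j k * (a : ℂ) ^ (-q) * (-((a : ℂ) * b)) ^ s := by
    rw [neg_sub, sub_eq_add_neg, zpow_add₀ ha, neg_mul_eq_mul_neg, mul_zpow]
    ring
  have c2 : (-(b : ℂ)) ^ s * (2 * kron i l * (-1) ^ p * (a : ℂ) ^ (p + s)) =
      2 * kron i l * (b : ℂ) ^ (-p) * (-((a : ℂ) * b)) ^ (p + s) := by
    rw [neg_mul_eq_mul_neg, mul_zpow, neg_eq_neg_one_mul (b : ℂ), mul_zpow, mul_zpow,
      zpow_add₀ hb, zpow_add₀ (show (-1 : ℂ) ≠ 0 by norm_num), zpow_neg]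
    field_simp
  have c3 : (-(b : ℂ)) ^ s * (2 * kron i k * (-1) ^ p * (a : ℂ) ^ (p + (q - s))) =
      2 * kron i k * (-1) ^ q * (b : ℂ) ^ (p + q) *
        (-((a : ℂ) * (b : ℂ)⁻¹)) ^ (p + q - s) := by
    have e1 : (b : ℂ) ^ (p + q) * ((b : ℂ)⁻¹) ^ (p + q - s) = (b : ℂ) ^ s := by
      rw [inv_zpow', ← zpow_add₀ hb]
      congr 1
      ring
    have e2 : (-1 : ℂ) ^ q * (-1) ^ (p + q - s) = (-1) ^ p * (-1) ^ s := by
      have e3 : (-1 : ℂ) ^ (-s) = (-1) ^ s := by rw [zpow_neg, ← inv_zpow]; norm_num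
      rw [sub_eq_add_neg, zpow_add₀ (by norm_num), zpow_add₀ (by norm_num), e3]
      linear_combination (-1 : ℂ) ^ p * (-1) ^ s * n1 q
    rw [← add_sub_assoc, neg_eq_neg_one_mul (b : ℂ), neg_eq_neg_one_mul ((a : ℂ) * _), mul_zpow,
      mul_zpow, mul_zpow, ← e1]
    linear_combination (-2 * kron i k * (a : ℂ) ^ (p + q - s) * (b : ℂ) ^ (p + q) *
      ((b : ℂ)⁻¹) ^ (p + q - s)) * e2
  have c4 : (-(b : ℂ)) ^ s * (2 * kron j l * (a : ℂ) ^ (-s)) =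
      2 * kron j l * (-((b : ℂ) * (a : ℂ)⁻¹)) ^ q * (-((a : ℂ) * (b : ℂ)⁻¹)) ^ (q - s) := by
    have : -((a : ℂ) * (b : ℂ)⁻¹) = (-((b : ℂ) * (a : ℂ)⁻¹))⁻¹ := by
      rw [inv_neg, mul_inv, inv_inv, mul_comm]
    rw [this, inv_zpow', mul_assoc _ _ (_ ^ (-(q - s))), ← zpow_add₀ (by simp [ha, hb]),
      show q + -(q - s) = s by ring, neg_mul_eq_neg_mul, mul_zpow, inv_zpow']
    ring
  rw [mul_smul_comm, smul_mul_assoc, ← smul_sub, e5, h.commutator_fermion, h.commutator_fermion,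
    e3, e4, sub_mul, mul_sub, smul_mul_assoc, smul_mul_assoc, mul_smul_comm, mul_smul_comm,
    show p + (q - s) = p + q - s by ring]
  rw [show p + (q - s) = p + q - s by ring] at c3
  -- With the four products as atoms, the remaining identity is linear.
  generalize ψ i (p + q - s) * ψ l s = P1
  generalize ψ j (p + q - s) * ψ l s = P2
  generalize ψ k (q - s) * ψ i (p + s) = P3
  generalize ψ k (q - s) * ψ j (p + s) = P4
  simp only [smul_smul]
  rw [← c1, ← c2, ← c3, ← c4]
  module

end IsFermionBilinear

end Bilinear

section Fock

variable {ν : ℕ}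

/-! ### The Heisenberg modes on the symmetric algebra as an instance -/

theorem mode_basisVec (i : Fin ν) (n : ℤ) : mode (basisVec i) n = basisMode i n := by
  rw [mode, Finset.sum_eq_single i]
  · simp [basisVec]
  · intro j _ hj
    simp [basisVec, hj]
  · simp

theorem mode_neg_basisVec (i : Fin ν) (n : ℤ) :
    mode (-basisVec i) n = (-1 : ℂ) • basisMode i n := by
  rw [mode, Finset.sum_eq_single i]
  · simp [basisVec]
  · intro j _ hj
    simp [basisVec, hj]
  · simp

theorem isHeisenberg_basisMode : IsHeisenberg (V := SymAlg ν) basisMode where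
  eq_zero i _ := basisMode_of_not_odd i
  commute_neg := commute_basisMode_neg
  commute_pos := commute_basisMode
  commutator := basisMode_commutator

theorem EMinus_basisVec (i : Fin ν) (c : ℂˣ) :
    EMinus (basisVec i) c = expMinus (V := SymAlg ν) (basisMode i) c := by
  refine congrArg expSeries (PowerSeries.ext fun k => ?_)
  rw [PowerSeries.coeff_mk, exponent, mode_basisVec, neg_neg, zpow_natCast]
  refine Eq.trans ?_ (coeff_logMinus (V := SymAlg ν) (basisMode i) c k).symm
  push_cast
  rw [neg_div_neg_eq]

theorem EPlus_basisVec (i : Fin ν) (c : ℂˣ) :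
    EPlus (basisVec i) c = expPlus (V := SymAlg ν) (basisMode i) c := by
  refine congrArg expSeries (PowerSeries.ext fun k => ?_)
  rw [PowerSeries.coeff_mk, exponent, mode_basisVec, zpow_neg, zpow_natCast, ← inv_pow]
  refine Eq.trans ?_ (coeff_logPlus (V := SymAlg ν) (basisMode i) c k).symm
  push_cast
  rfl

/-- Oddness again: it turns E_±(-ε_i, cz) into E_±(ε_i, -cz). -/
theorem neg_pow_smul_basisMode (i : Fin ν) (x c : ℂ) {k : ℕ} {n : ℤ} (hn : n.natAbs = k) :
    (x * (-c) ^ k) • basisMode i n = (x * c ^ k) • (-1 : ℂ) • basisMode i n := by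
  by_cases h : Odd k
  · rw [h.neg_pow, smul_smul, mul_neg, mul_neg_one]
  · rw [basisMode_of_not_odd i (hn ▸ h), smul_zero, smul_zero, smul_zero]

theorem EMinus_neg_basisVec (i : Fin ν) (c : ℂˣ) :
    EMinus (-basisVec i) c = expMinus (V := SymAlg ν) (basisMode i) (-c) := by
  refine congrArg expSeries (PowerSeries.ext fun k => ?_)
  rw [PowerSeries.coeff_mk, exponent, mode_neg_basisVec, neg_neg, zpow_natCast]
  refine Eq.trans ?_ (coeff_logMinus (V := SymAlg ν) (basisMode i) (-c) k).symm
  refine Eq.trans ?_ (neg_pow_smul_basisMode i _ (c : ℂ) (by simp)).symm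
  push_cast
  rw [neg_div_neg_eq]

theorem EPlus_neg_basisVec (i : Fin ν) (c : ℂˣ) :
    EPlus (-basisVec i) c = expPlus (V := SymAlg ν) (basisMode i) (-c) := by
  refine congrArg expSeries (PowerSeries.ext fun k => ?_)
  rw [PowerSeries.coeff_mk, exponent, mode_neg_basisVec, zpow_neg, zpow_natCast, ← inv_pow]
  refine Eq.trans ?_ (coeff_logPlus (V := SymAlg ν) (basisMode i) (-c) k).symm
  rw [Units.val_neg, inv_neg]
  refine Eq.trans ?_ (neg_pow_smul_basisMode i _ _ (by simp)).symm
  push_cast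
  rfl

theorem Lowering.jointlyFinite {B B' : PowerSeries (Module.End ℂ (SymAlg ν))} (hB : Lowering B)
    (hB' : Lowering B') : JointlyFinite (V := SymAlg ν) B B' := by
  intro v
  refine ⟨v.support.sup monWeight + 1, fun q q' hq => ?_⟩
  have hv : v ∈ filt ν ((v.support.sup monWeight : ℕ) : ℤ) := by
    intro m hm
    exact Int.ofNat_le.mpr
      (Finset.le_sup (f := monWeight) (MvPolynomial.mem_support_iff.mpr hm))
  have h := hB q _ _ (hB' q' _ v hv)
  refine MvPolynomial.ext _ _ fun m => ?_
  rw [MvPolynomial.coeff_zero]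
  by_contra hm
  have := h m hm
  omega

theorem jointlyFinite_expPlus_basisMode (i j : Fin ν) (c d : ℂˣ) :
    JointlyFinite (V := SymAlg ν) (expPlus (basisMode i) c) (expPlus (basisMode j) d) := by
  rw [← EPlus_basisVec, ← EPlus_basisVec]
  exact (lowering_EPlus _ _).jointlyFinite (lowering_EPlus _ _)

theorem locallyFinite_expPlus_basisMode (i : Fin ν) (c : ℂˣ) :
    LocallyFinite (V := SymAlg ν) (expPlus (basisMode i) c) := by
  rw [← EPlus_basisVec]
  exact (lowering_EPlus _ _).locallyFinite

theorem bosonCoeff_eq (i j : Fin ν) (a : ℂˣ) (n : ℤ) :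
    bosonCoeff i j a n = mixedCoeff (V := SymAlg ν)
      (expMinus (basisMode i) 1 * expMinus (basisMode j) (-a))
      (expPlus (basisMode i) 1 * expPlus (basisMode j) (-a))
      (jointlyFinite_expPlus_basisMode i j 1 (-a)).locallyFinite_mul n :=
  mixedCoeff_congr (congrArg₂ _ (EMinus_basisVec i 1) (EMinus_neg_basisVec j a))
    (congrArg₂ _ (EPlus_basisVec i 1) (EPlus_neg_basisVec j a)) _ _ n

/-! ### The twisted group algebra -/

theorem cocycle_basisVec (i j : Fin ν) :
    cocycle (basisVec i) (basisVec j) = cocycleBasis i j := by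
  rw [cocycle, Finset.prod_eq_single i, Finset.prod_eq_single j]
  · simp [basisVec]
  · intro k _ hk
    simp [basisVec, hk]
  · simp
  · intro k _ hk
    simp [basisVec, hk]
  · simp

theorem expOp_single (x y : LatticeBar ν) (c : ℂ) :
    expOp x (Finsupp.single y c) =
      c • (((cocycleBar x y : ℤˣ) : ℤ) : ℂ) • Finsupp.single (x + y) (1 : ℂ) :=
  Finsupp.linearCombination_single _ _ _

/-- The cocycle identity, immediate from bimultiplicativity; it makes `expOp` a projective
representation. -/
theorem cocycleBar_mul (x y z : LatticeBar ν) :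
    cocycleBar y z * cocycleBar x (y + z) = cocycleBar x y * cocycleBar (x + y) z := by
  induction x using QuotientAddGroup.induction_on with | H x => ?_
  induction y using QuotientAddGroup.induction_on with | H y => ?_
  induction z using QuotientAddGroup.induction_on with | H z => ?_
  change cocycle y z * cocycle x (y + z) = cocycle x y * cocycle (x + y) z
  rw [cocycle_add_left, cocycle_add_right]
  exact mul_left_comm _ _ _ |>.trans (by rw [mul_comm (cocycle y z)])

theorem expOp_mul (x y : LatticeBar ν) :
    expOp x * expOp y = (((cocycleBar x y : ℤˣ) : ℤ) : ℂ) • expOp (x + y) := by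
  refine Finsupp.lhom_ext fun z c => ?_
  rw [Module.End.mul_apply, LinearMap.smul_apply, expOp_single, expOp_single, map_smul, map_smul,
    expOp_single, one_smul, smul_smul, smul_smul, smul_smul, smul_smul, add_assoc]
  congr 1
  have := congrArg (fun u : ℤˣ => ((u : ℤ) : ℂ)) (cocycleBar_mul x y z)
  simp only [Units.val_mul, Int.cast_mul] at this
  rw [mul_assoc, this]
  ring

theorem expOp_zero : expOp (0 : LatticeBar ν) = 1 := by
  refine Finsupp.lhom_ext fun z c => ?_
  have h : cocycleBar (0 : LatticeBar ν) z = 1 := by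
    induction z using QuotientAddGroup.induction_on with | H z => ?_
    change cocycle 0 z = 1
    simp [cocycle]
  rw [expOp_single, h, zero_add]
  simp

theorem mk_add_self (x : LatticeZ ν) :
    (QuotientAddGroup.mk x + QuotientAddGroup.mk x : LatticeBar ν) = 0 := by
  rw [← QuotientAddGroup.mk_add, QuotientAddGroup.eq_zero_iff]
  exact ⟨x, by simp [two_smul]⟩

theorem mk_sub (x y : LatticeZ ν) : (QuotientAddGroup.mk (x - y) : LatticeBar ν) =
    QuotientAddGroup.mk x + QuotientAddGroup.mk y := by
  rw [QuotientAddGroup.mk_sub, sub_eq_iff_eq_add, add_assoc, mk_add_self, add_zero]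

/-- The operator `e^(ε_i)`. -/
def expBasis (i : Fin ν) : Module.End ℂ (GroupAlg ν) := expOp (QuotientAddGroup.mk (basisVec i))

/-- Modulo 2Γ the classes of ε_i - ε_j and ε_i + ε_j agree, so the prefactor of X_ij is exactly
e^(ε_i) e^(ε_j). -/
theorem expBasis_mul (i j : Fin ν) : expBasis i * expBasis j =
    (((cocycle (basisVec i) (basisVec j) : ℤˣ) : ℤ) : ℂ) •
      expOp (QuotientAddGroup.mk (basisVec i - basisVec j)) := by
  rw [expBasis, expBasis, expOp_mul, mk_sub]
  rfl

theorem expBasis_mul_self (i : Fin ν) : expBasis i * expBasis i = 1 := by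
  rw [expBasis_mul, sub_self, QuotientAddGroup.mk_zero, expOp_zero, cocycle_basisVec]
  simp [cocycleBasis]

/-- Exactly one of the two cocycle values is -1; this sign makes fermions with distinct indices
anticommute. -/
theorem expBasis_mul_of_ne {i j : Fin ν} (h : i ≠ j) :
    expBasis j * expBasis i = (-1 : ℂ) • (expBasis i * expBasis j) := by
  rw [expBasis_mul, expBasis_mul, mk_sub, mk_sub, add_comm (QuotientAddGroup.mk (basisVec j)),
    smul_smul, cocycle_basisVec, cocycle_basisVec]
  congr 1
  rcases lt_or_gt_of_ne h with h' | h'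
  · simp [cocycleBasis, h'.le, not_le.mpr h']
  · simp [cocycleBasis, h'.le, not_le.mpr h']

/-! ### Fermions on the Fock space -/

theorem tensorOp_mul (g g' : Module.End ℂ (GroupAlg ν)) (f f' : Module.End ℂ (SymAlg ν)) :
    tensorOp g f * tensorOp g' f' = tensorOp (g * g') (f * f') :=
  (TensorProduct.map_mul g g' f f').symm

theorem tensorOp_one : tensorOp (1 : Module.End ℂ (GroupAlg ν)) 1 = 1 :=
  TensorProduct.map_one

theorem tensorOp_smul_left (c : ℂ) (g : Module.End ℂ (GroupAlg ν))
    (f : Module.End ℂ (SymAlg ν)) : tensorOp (c • g) f = c • tensorOp g f :=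
  TensorProduct.map_smul_left c g f

theorem tensorOp_smul_right (c : ℂ) (g : Module.End ℂ (GroupAlg ν))
    (f : Module.End ℂ (SymAlg ν)) : tensorOp g (c • f) = c • tensorOp g f :=
  TensorProduct.map_smul_right c g f

theorem tensorOp_add_right (g : Module.End ℂ (GroupAlg ν)) (f f' : Module.End ℂ (SymAlg ν)) :
    tensorOp g (f + f') = tensorOp g f + tensorOp g f' :=
  TensorProduct.map_add_right g f f'

theorem tensorOp_sub_right (g : Module.End ℂ (GroupAlg ν)) (f f' : Module.End ℂ (SymAlg ν)) :
    tensorOp g (f - f') = tensorOp g f - tensorOp g f' := by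
  rw [eq_sub_iff_add_eq, ← tensorOp_add_right]
  exact congrArg _ (sub_add_cancel f f')

/-- The modes of the vertex operator of `ε_i` on `S(H⁻)`. -/
def symMode (i : Fin ν) (n : ℤ) : Module.End ℂ (SymAlg ν) :=
  vertexMode (V := SymAlg ν) (basisMode i) (locallyFinite_expPlus_basisMode i 1) n

/-- The fermions on the Fock space. -/
def fermion (i : Fin ν) (n : ℤ) : Module.End ℂ (Fock ν) := tensorOp (expBasis i) (symMode i n)

theorem symMode_mul_of_ne {i j : Fin ν} (h : i ≠ j) (m n : ℤ) :
    symMode i m * symMode j n = normalMode (V := SymAlg ν) (basisMode i) (basisMode j) m n :=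
  isHeisenberg_basisMode.vertexMode_mul_of_ne (jointlyFinite_expPlus_basisMode i j 1 1) h _ _ m n

theorem symMode_comm {i j : Fin ν} (h : i ≠ j) (m n : ℤ) :
    symMode i m * symMode j n = symMode j n * symMode i m := by
  rw [symMode_mul_of_ne h, symMode_mul_of_ne h.symm]
  exact isHeisenberg_basisMode.normalMode_swap (jointlyFinite_expPlus_basisMode i j 1 1)
    (jointlyFinite_expPlus_basisMode j i 1 1) m n

theorem symMode_anticomm (i : Fin ν) (m n : ℤ) :
    symMode i m * symMode i n + symMode i n * symMode i m =
      (if m + n = 0 then 2 * (-1 : ℂ) ^ n else 0) • 1 :=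
  isHeisenberg_basisMode.vertexMode_anticomm (jointlyFinite_expPlus_basisMode i i 1 1) _ m n

theorem kron_self {ι : Type*} [DecidableEq ι] (i : ι) : kron i i = 1 := if_pos rfl

theorem kron_of_ne {ι : Type*} [DecidableEq ι] {i j : ι} (h : i ≠ j) : kron i j = 0 := if_neg h

theorem add_neg_one_smul {W : Type*} [AddCommGroup W] [Module ℂ W] (x : W) :
    x + (-1 : ℂ) • x = 0 := by
  rw [neg_one_smul, add_neg_cancel]

/-- On the diagonal the group algebra factor is 1 and the bosonic relations apply directly; off the
diagonal the vacuum value is zero and the product is already normally ordered. -/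
theorem isFermionBilinear_vertexOp :
    IsFermionBilinear (V := Fock ν) fermion vertexOp where
  anticomm i j m n := by
    by_cases h : i = j
    · subst h
      rw [fermion, fermion, tensorOp_mul, tensorOp_mul, expBasis_mul_self, kron_self, one_mul,
        vacuumValue_add_vacuumValue_swap, ← tensorOp_add_right, symMode_anticomm,
        tensorOp_smul_right, tensorOp_one]
    · rw [fermion, fermion, tensorOp_mul, tensorOp_mul, kron_of_ne h, zero_mul, zero_smul,
        symMode_comm h, expBasis_mul_of_ne h, tensorOp_smul_left]
      exact add_neg_one_smul _
  hasOpSum i j a p := by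
    by_cases h : i = j
    · subst h
      have h1 := (isHeisenberg_basisMode.hasOpSum_bilinear_self
        (jointlyFinite_expPlus_basisMode i i 1 1) (locallyFinite_expPlus_basisMode i 1) a
        (jointlyFinite_expPlus_basisMode i i 1 (-a)).locallyFinite_mul p).tensorOp
          (1 : Module.End ℂ (GroupAlg ν))
      refine (h1.congr fun n => ?_).congr' ?_
      · rw [fermion, fermion, tensorOp_mul, expBasis_mul_self, kron_self, one_mul, ← tensorOp_one,
          ← tensorOp_smul_right, ← tensorOp_sub_right, ← tensorOp_smul_right]
        rfl
      · rw [vertexOp, if_pos rfl]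
        split_ifs with ha hp
        · exact tensorOp_smul_right _ _ _
        · refine (tensorOp_smul_right _ _ _).trans (congrArg _ ?_)
          rw [constSeries, if_pos hp, ← tensorOp_one, ← tensorOp_sub_right, bosonCoeff_eq]
        · refine (tensorOp_smul_right _ _ _).trans (congrArg _ ?_)
          rw [constSeries, if_neg hp, sub_zero, bosonCoeff_eq]
          exact (sub_zero _).symm
    · have h1 := (hasOpSum_normalMode_diag (V := SymAlg ν) (c := -a)
        (jointlyFinite_expPlus_basisMode i j 1 1)
        (jointlyFinite_expPlus_basisMode i j 1 (-a)).locallyFinite_mul p).tensorOp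
          (expBasis i * expBasis j)
      refine (h1.congr fun n => ?_).congr' ?_
      · rw [fermion, fermion, tensorOp_mul, kron_of_ne h, zero_mul, zero_smul, sub_zero,
          symMode_mul_of_ne h, ← tensorOp_smul_right, Units.val_neg]
      · rw [vertexOp, if_neg h, bosonCoeff_eq, expBasis_mul, tensorOp_smul_left]

end Fock

/-! ### Calculus of formal series -/

theorem mulSeries_substRatio_delta {V : Type*} [AddCommGroup V] [Module ℂ V] (A : Series V)
    (c : ℂˣ) (p q : ℤ) :
    mulSeries A (substRatio delta c) p q = (c : ℂ) ^ q • A (p + q) := by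
  rw [mulSeries, finsum_eq_single _ (p + q)]
  · rw [substRatio, if_pos (by ring), delta, one_mul]
  · intro r hr
    rw [substRatio, if_neg (by omega), zero_smul]

/-- Both cases in one formula: the two parts of 1 - u^(-p) are the constants attached to two delta
series, and the last term is the coefficient of Dδ. -/
theorem vacuumDefect_units (u : ℂˣ) (p : ℤ) :
    vacuumDefect u p = (1 - (u : ℂ) ^ (-p)) * ((1 - kron u 1) * ((1 + (u : ℂ)) / (1 - u))) -
      2 * p * kron u 1 := by
  rw [vacuumDefect]
  by_cases h : u = 1
  · rw [if_pos (by rw [h, Units.val_one]), h, kron_self]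
    ring
  · rw [if_neg (by simpa using h), kron_of_ne h]
    ring


theorem IsFermionBilinear.seriesBracket_eq {ι V : Type*} [DecidableEq ι] [AddCommGroup V]
    [Module ℂ V] {ψ : ι → ℤ → Module.End ℂ V} {X : ι → ι → ℂˣ → ℤ → Module.End ℂ V}
    (h : IsFermionBilinear ψ X) (i j k l : ι) (a b : ℂˣ) :
    seriesBracket (X i j a) (X k l b) =
      (2 * kron j k) •
        mulSeries
          (X i l (a * b) +
            constSeries ((kron i l * (1 - kron (a * b) 1) *
              ((1 + (a : ℂ) * b) / (1 - (a : ℂ) * b))) • (1 : Module.End ℂ V)))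
          (substRatio delta a⁻¹)
      - (2 * kron i l) •
        mulSeries
          (scale (X k j (a * b)) b⁻¹ +
            constSeries ((kron j k * (1 - kron (a * b) 1) *
              ((1 + (a : ℂ) * b) / (1 - (a : ℂ) * b))) • (1 : Module.End ℂ V)))
          (substRatio delta b)
      + (2 * kron i k) •
        mulSeries
          (scale (X l j (a * b⁻¹)) b +
            constSeries ((kron j l * (1 - kron a b) *
              ((1 + (a : ℂ) * (b : ℂ)⁻¹) / (1 - (a : ℂ) * (b : ℂ)⁻¹))) •
                (1 : Module.End ℂ V)))
          (substRatio delta (-1))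
      - (2 * kron j l) •
        mulSeries
          (X i k (a * b⁻¹) +
            constSeries ((kron i k * (1 - kron a b) *
              ((1 + (a : ℂ) * (b : ℂ)⁻¹) / (1 - (a : ℂ) * (b : ℂ)⁻¹))) •
                (1 : Module.End ℂ V)))
          (substRatio delta (-(b * a⁻¹)))
      + (4 * kron i l * kron j k * kron (a * b) 1) •
        smulConst (substRatio (euler delta) a⁻¹) (1 : Module.End ℂ V)
      - (4 * kron i k * kron j l * kron a b) •
        smulConst (substRatio (euler delta) (-1)) (1 : Module.End ℂ V) := by
  have ha : (a : ℂ) ≠ 0 := a.ne_zero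
  have hb : (b : ℂ) ≠ 0 := b.ne_zero
  have hab : kron a b = kron (a * b⁻¹) 1 := by simp only [kron, mul_inv_eq_one]
  funext p q
  simp only [seriesBracket, h.commutator, Pi.add_apply, Pi.sub_apply, Pi.smul_apply,
    mulSeries_substRatio_delta, smulConst, substRatio, euler, delta, scale, constSeries,
    Units.val_inv_eq_inv_val, Units.val_neg, Units.val_one, Units.val_mul]
  have e1 : ((a : ℂ)⁻¹) ^ q = (a : ℂ) ^ (-q) := inv_zpow' _ _
  have e2 : (b : ℂ) ^ q * ((b : ℂ)⁻¹) ^ (p + q) = (b : ℂ) ^ (-p) := by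
    rw [inv_zpow', ← zpow_add₀ hb]
    congr 1
    ring
  rw [e1]
  by_cases ht : p + q = 0
  · obtain rfl : q = -p := by omega
    have d1 := vacuumDefect_units (a * b) p
    have d2 := vacuumDefect_units (a * b⁻¹) (-p)
    simp only [Units.val_inv_eq_inv_val, Units.val_mul] at d1 d2
    simp only [ht, if_true]
    rw [d1, d2, hab]
    have f1 : (a : ℂ) ^ p * ((a : ℂ) * b) ^ (-p) = (b : ℂ) ^ (-p) := by
      rw [mul_zpow, ← mul_assoc, ← zpow_add₀ ha, add_neg_cancel, zpow_zero, one_mul]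
    have f2 : (-1 : ℂ) ^ (-p) = (-1) ^ p := by rw [zpow_neg, ← inv_zpow]; norm_num
    have f3 : (-1 : ℂ) ^ p * ((a : ℂ) * (b : ℂ)⁻¹) ^ p = (-((b : ℂ) * (a : ℂ)⁻¹)) ^ (-p) := by
      have : -((b : ℂ) * (a : ℂ)⁻¹) = (-1 * ((a : ℂ) * (b : ℂ)⁻¹))⁻¹ := by
        rw [neg_one_mul, inv_neg, mul_inv, inv_inv, mul_comm]
      rw [this, inv_zpow', neg_neg, mul_zpow (-1 : ℂ)]
    -- On p + q = 0, `f1` and `f3` identify the u^(∓p) parts of the defects with the coefficients of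
    -- δ(bw/z) and δ(-bw/(az)).
    rw [← f1, ← f3, f2, neg_neg]
    simp only [zpow_zero]
    push_cast
    module
  · simp only [if_neg ht, zero_smul, add_zero, smul_zero, sub_zero, smul_smul]
    rw [← e2]
    module

end TwistedVertex
end

theorem theorem2p15 {ν : ℕ} (i j k l : Fin ν) (a b : ℂˣ) :
    seriesBracket (vertexOp i j a) (vertexOp k l b) =
      (2 * kron j k) •
        mulSeries
          (vertexOp i l (a * b) +
            constSeries ((kron i l * (1 - kron (a * b) 1) *
              ((1 + (a : ℂ) * b) / (1 - (a : ℂ) * b))) • (1 : Module.End ℂ (Fock ν))))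
          (substRatio delta a⁻¹)
      - (2 * kron i l) •
        mulSeries
          (scale (vertexOp k j (a * b)) b⁻¹ +
            constSeries ((kron j k * (1 - kron (a * b) 1) *
              ((1 + (a : ℂ) * b) / (1 - (a : ℂ) * b))) • (1 : Module.End ℂ (Fock ν))))
          (substRatio delta b)
      + (2 * kron i k) •
        mulSeries
          (scale (vertexOp l j (a * b⁻¹)) b +
            constSeries ((kron j l * (1 - kron a b) *
              ((1 + (a : ℂ) * (b : ℂ)⁻¹) / (1 - (a : ℂ) * (b : ℂ)⁻¹))) •
                (1 : Module.End ℂ (Fock ν))))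
          (substRatio delta (-1))
      - (2 * kron j l) •
        mulSeries
          (vertexOp i k (a * b⁻¹) +
            constSeries ((kron i k * (1 - kron a b) *
              ((1 + (a : ℂ) * (b : ℂ)⁻¹) / (1 - (a : ℂ) * (b : ℂ)⁻¹))) •
                (1 : Module.End ℂ (Fock ν))))
          (substRatio delta (-(b * a⁻¹)))
      + (4 * kron i l * kron j k * kron (a * b) 1) •
        smulConst (substRatio (euler delta) a⁻¹) (1 : Module.End ℂ (Fock ν))
      - (4 * kron i k * kron j l * kron a b) •
        smulConst (substRatio (euler delta) (-1)) (1 : Module.End ℂ (Fock ν)) :=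
  isFermionBilinear_vertexOp.seriesBracket_eq i j k l a b
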